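/- Let $(\varphi_i,d_i)_{i\ge 1}$ be i.i.d. pairs of a random vector $\varphi_i\in\mathbb{R}^n$ and a real Gaussian noise $d_i\sim\mathcal N(m,v)$, $v>0$, with $\varphi_i$ independent of $d_i$. Assume $\mathbb E\|\varphi_1\|^2<\infty$ and the persistent excitation condition that, almost surely, the matrix $\sum_{i=1}^N\varphi_i\varphi_i^T$ is positive definite for some $N$. Fix $C\in\mathbb R$ and the true parameter $\theta\in\mathbb R^n$, and observe $s_i=\mathbb I(\varphi_i^T\theta-C+d_i\le 0)$. Let $F$ be the distribution function of $d_i$, put $p(1\mid x,\gamma)=F(C-x^T\gamma)$ and $p(0\mid x,\gamma)=1-F(C-x^T\gamma)$, and let $$L_N(\gamma)=\prod_{i=1}^N p(s_i\mid\varphi_i,\gamma),\qquad l_N(\gamma)=\log L_N(\gamma),\qquad s_N(\gamma)=\nabla l_N(\gamma)$$ be the likelihood, the log-likelihood and the score. Let $$I(\theta)=\mathbb E\Big[\sum_{s\in\{0,1\}}p(s\mid\varphi_1,\theta)\,\nabla_\theta\log p(s\mid\varphi_1,\theta)\,\nabla_\theta\log p(s\mid\varphi_1,\theta)^T\Big]$$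 be the Fisher information matrix of one observation. Then the entries of $I(\theta)$ are integrals of integrable functions, $I(\theta)$ is positive definite, and there exist random vectors $\hat\theta_N$, each a measurable function of $(\varphi_1,s_1),\dots,(\varphi_N,s_N)$, and a random integer $n_2$ such that 1. $P\big(s_N(\hat\theta_N)=0 \text{ and } \hat\theta_N \text{ maximizes } l_N \text{ over } \mathbb R^n,\ \forall N\ge n_2\big)=1$; 2. $\hat\theta_N\to\theta$ almost surely; 3. $\sqrt N(\hat\theta_N-\theta)\xrightarrow{d}\mathcal N(0,I(\theta)^{-1})$. -/

import Mathlib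

open MeasureTheory ProbabilityTheory Filter Topology
open scoped RealInnerProductSpace NNReal

namespace SetValued

/-- The binary observation `s = 𝕀(y ≤ 0)` of the latent variable `y = φᵀθ - C + d`. -/
noncomputable def obs {n : ℕ} (C : ℝ) (θ φ : EuclideanSpace ℝ (Fin n)) (d : ℝ) : ℕ :=
  if ⟪φ, θ⟫ - C + d ≤ 0 then 1 else 0

/-- The conditional probability `P{s | φ, γ}` of an observation `s ∈ {0, 1}` given the input `φ`,
under the parameter `γ`, when the noise has distribution function `F`:
`F(C - φᵀγ)` for `s = 1` and `1 - F(C - φᵀγ)` for `s = 0`. -/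
noncomputable def obsProb {n : ℕ} (F : ℝ → ℝ) (C : ℝ) (φ : EuclideanSpace ℝ (Fin n)) (s : ℕ)
    (γ : EuclideanSpace ℝ (Fin n)) : ℝ :=
  if s = 1 then F (C - ⟪φ, γ⟫) else 1 - F (C - ⟪φ, γ⟫)

/-- The likelihood `L_N(γ)` of the first `N` observations given the first `N` inputs. -/
noncomputable def likelihood {n : ℕ} (F : ℝ → ℝ) (C : ℝ) (φ : ℕ → EuclideanSpace ℝ (Fin n))
    (s : ℕ → ℕ) (N : ℕ) (γ : EuclideanSpace ℝ (Fin n)) : ℝ :=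
  ∏ i ∈ Finset.range N, obsProb F C (φ i) (s i) γ

/-- The log-likelihood `l_N(γ) = log L_N(γ)`. -/
noncomputable def logLikelihood {n : ℕ} (F : ℝ → ℝ) (C : ℝ) (φ : ℕ → EuclideanSpace ℝ (Fin n))
    (s : ℕ → ℕ) (N : ℕ) (γ : EuclideanSpace ℝ (Fin n)) : ℝ :=
  Real.log (likelihood F C φ s N γ)

/-- The score `s_N(γ) = ∇ l_N(γ)`. -/
noncomputable def score {n : ℕ} (F : ℝ → ℝ) (C : ℝ) (φ : ℕ → EuclideanSpace ℝ (Fin n))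
    (s : ℕ → ℕ) (N : ℕ) (γ : EuclideanSpace ℝ (Fin n)) : EuclideanSpace ℝ (Fin n) :=
  gradient (logLikelihood F C φ s N) γ

/-- The Fisher information at `θ` of one observation given the input `x`, i.e. the conditional
expectation of `∇ log p(s | x, θ) (∇ log p(s | x, θ))ᵀ` where `s` has the law `p(· | x, θ)`. -/
noncomputable def condFisherInfo {n : ℕ} (F : ℝ → ℝ) (C : ℝ) (θ x : EuclideanSpace ℝ (Fin n)) :
    Matrix (Fin n) (Fin n) ℝ :=
  Matrix.of fun a b => ∑ s ∈ ({0, 1} : Finset ℕ), obsProb F C x s θ *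
    ((gradient (fun γ => Real.log (obsProb F C x s γ)) θ) a *
      (gradient (fun γ => Real.log (obsProb F C x s γ)) θ) b)

/-- The Fisher information matrix `I(θ)` of one pair `(φ, s)`, where the input `φ` has law `P`
(which does not depend on the parameter) and `s` has the conditional law `p(· | φ, θ)`. -/
noncomputable def fisherInfo {n : ℕ} (F : ℝ → ℝ) (C : ℝ) (P : Measure (EuclideanSpace ℝ (Fin n)))
    (θ : EuclideanSpace ℝ (Fin n)) : Matrix (Fin n) (Fin n) ℝ :=
  Matrix.of fun a b => ∫ x, condFisherInfo F C θ x a b ∂P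

/-- The excitation matrix `A = ∑_{i < N} φᵢ φᵢᵀ`. -/
noncomputable def excitation {n : ℕ} (φ : ℕ → EuclideanSpace ℝ (Fin n)) (N : ℕ) :
    Matrix (Fin n) (Fin n) ℝ :=
  ∑ i ∈ Finset.range N, Matrix.vecMulVec (φ i).ofLp (φ i).ofLp

end SetValued

/-! For Gaussian noise both `log F` and `log (1 - F)` are strictly concave, with second derivatives
in `[-1/v, 0)`. The log-likelihood is therefore concave in `γ` whatever the data, and strictly
concave once the inputs span the space. For concave functions local control near `θ` suffices: if
the gradient points inward on a small sphere around `θ`, a maximizer inside is a global one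
(`exists_isMaxOn_of_concaveOn_of_inner_gradient_neg`). No uniform law of large numbers over the
non-compact parameter space is needed.

The local control is the almost sure linearization `N⁻¹ s_N(γ) = N⁻¹ s_N(θ) - I(θ)(γ - θ) + O(κ ‖γ -
θ‖)`, valid on a fixed ball for all large `N` (`exists_ae_norm_linkScore_sub_le`). It follows from
the strong law applied to the Hessian at `θ` and to an envelope of the oscillation of the Hessian;
since the curvature is bounded, a second moment of the inputs is enough. As `N⁻¹ s_N(θ) → 0`, a
maximizer exists in every ball around `θ` for large `N`, which is existence and consistency.

Putting the zero of the score into the linearization gives `√N (θ̂_N - θ) = I(θ)⁻¹ N^(-1/2) s_N(θ)`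
up to a small relative error. The central limit theorem and a Slutsky argument give normality with
covariance `I⁻¹ I I⁻¹ = I⁻¹`. Here the covariance of the score equals the expected negative Hessian
because `p 1 + p 0 = 1` has vanishing second derivative. Finally `I(θ)` is positive definite because
its scalar weight is positive and excitation prevents the inputs from lying almost surely in a
hyperplane. -/

namespace SetValued

/-! ### Analytic properties of the Gaussian log-likelihood -/

/-- A binary response model with success probability `p 1 t` and failure probability `p 0 t` at
`t`, whose log-likelihoods have first derivatives `g`, second derivatives `h` and are strictly
concave with curvature at most `K`. -/
structure IsRegularLink (p g h : ℕ → ℝ → ℝ) (K : ℝ) : Prop where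
  pos : ∀ s t, 0 < p s t
  sum_one : ∀ t, p 1 t + p 0 t = 1
  hasDerivAt_log : ∀ s t, HasDerivAt (fun t => Real.log (p s t)) (g s t) t
  hasDerivAt_score : ∀ s t, HasDerivAt (g s) (h s t) t
  neg : ∀ s t, h s t < 0
  lower : ∀ s t, -K ≤ h s t
  cont : ∀ s, Continuous (h s)
  sum_score : ∀ t, p 1 t * g 1 t + p 0 t * g 0 t = 0
  info : ∀ t, p 1 t * (h 1 t + g 1 t ^ 2) + p 0 t * (h 0 t + g 0 t ^ 2) = 0

/-- An increasing function that starts from `0` at `-∞` is positive. Each Gaussian tail inequality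
below is reduced to this by differentiating. -/
theorem pos_of_hasDerivAt_of_tendsto_atBot {q q' : ℝ → ℝ} {a : ℝ}
    (hq : ∀ t < a, HasDerivAt q (q' t) t) (hpos : ∀ t < a, 0 < q' t)
    (hlim : Tendsto q atBot (𝓝 0)) {t : ℝ} (ht : t < a) : 0 < q t := by
  have hmono : StrictMonoOn q (Set.Iio a) := by
    refine strictMonoOn_of_deriv_pos (convex_Iio a)
      (fun x hx => (hq x hx).continuousAt.continuousWithinAt) fun x hx => ?_
    rw [interior_Iio] at hx
    rw [(hq x hx).deriv]
    exact hpos x hx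
  have h1 : q (t - 1) < q t := hmono (by simp; linarith) ht (by linarith)
  have h2 : 0 ≤ q (t - 1) := by
    refine le_of_tendsto hlim ?_
    filter_upwards [eventually_le_atBot (t - 1)] with x hx
    exact hmono.monotoneOn (by simp; linarith) (by simp; linarith) hx
  linarith

section Gaussian

variable (m : ℝ) {v : ℝ≥0}

theorem continuous_gaussianPDFReal (v : ℝ≥0) : Continuous (gaussianPDFReal m v) := by
  unfold gaussianPDFReal
  fun_prop

theorem hasDerivAt_gaussianPDFReal (hv : v ≠ 0) (t : ℝ) :
    HasDerivAt (gaussianPDFReal m v) (-((t - m) / v) * gaussianPDFReal m v t) t := by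
  have hv' : (v : ℝ) ≠ 0 := by exact_mod_cast hv
  unfold gaussianPDFReal
  have h1 : HasDerivAt (fun x : ℝ => -(x - m) ^ 2 / (2 * (v : ℝ)))
      (-(2 * (t - m)) / (2 * v)) t := by
    have := ((((hasDerivAt_id t).sub_const m).pow 2).neg).div_const (2 * (v : ℝ))
    simpa using this
  refine (h1.exp.const_mul _).congr_deriv ?_
  field_simp

theorem tendsto_mul_gaussianPDFReal_atBot (hv : v ≠ 0) :
    Tendsto (fun t => (t - m) * gaussianPDFReal m v t) atBot (𝓝 0) := by
  have hv' : (0 : ℝ) < v := by exact_mod_cast pos_iff_ne_zero.2 hv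
  have h := (tendsto_rpow_abs_mul_exp_neg_mul_sq_cocompact
    (a := 1 / (2 * (v : ℝ))) (by positivity) 1).mono_left atBot_le_cocompact
  have h2 := h.comp (tendsto_atBot_add_const_right atBot (-m) tendsto_id)
  have h3 := h2.const_mul ((√(2 * Real.pi * v))⁻¹)
  rw [mul_zero] at h3
  refine squeeze_zero_norm (fun t => ?_) h3
  rw [norm_mul, Real.norm_eq_abs, Real.norm_eq_abs, abs_of_nonneg (gaussianPDFReal_nonneg _ _ _)]
  simp only [Function.comp, Real.rpow_one, gaussianPDFReal, id]
  rw [← sub_eq_add_neg]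
  apply le_of_eq
  rw [show -(t - m) ^ 2 / (2 * (v : ℝ)) = -(1 / (2 * v)) * (t - m) ^ 2 by ring]
  ring

theorem tendsto_gaussianPDFReal_atBot (hv : v ≠ 0) :
    Tendsto (gaussianPDFReal m v) atBot (𝓝 0) := by
  have h := (tendsto_mul_gaussianPDFReal_atBot m hv).norm
  rw [norm_zero] at h
  refine squeeze_zero_norm' ?_ h
  filter_upwards [eventually_le_atBot (m - 1)] with t ht
  rw [norm_mul]
  refine le_mul_of_one_le_left (norm_nonneg _) ?_
  rw [Real.norm_eq_abs, abs_of_nonpos (by linarith)]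
  linarith

theorem cdf_gaussianReal_eq_integral (hv : v ≠ 0) (t : ℝ) :
    cdf (gaussianReal m v) t = ∫ x in Set.Iic t, gaussianPDFReal m v x := by
  rw [cdf_eq_real, measureReal_def, gaussianReal_apply_eq_integral m hv, ENNReal.toReal_ofReal]
  exact integral_nonneg fun x => gaussianPDFReal_nonneg _ _ _

theorem hasDerivAt_cdf_gaussianReal (hv : v ≠ 0) (t : ℝ) :
    HasDerivAt (cdf (gaussianReal m v)) (gaussianPDFReal m v t) t := by
  have hc := continuous_gaussianPDFReal m v
  have heq : (fun t => cdf (gaussianReal m v) t) =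
      fun t => (∫ x in (0 : ℝ)..t, gaussianPDFReal m v x) + cdf (gaussianReal m v) 0 := by
    funext t
    rw [cdf_gaussianReal_eq_integral m hv, cdf_gaussianReal_eq_integral m hv,
      ← intervalIntegral.integral_Iic_sub_Iic (integrable_gaussianPDFReal m v).integrableOn
        (integrable_gaussianPDFReal m v).integrableOn]
    ring
  change HasDerivAt (fun t => cdf (gaussianReal m v) t) _ _
  rw [heq]
  exact (intervalIntegral.integral_hasDerivAt_right (hc.intervalIntegrable _ _)
    (hc.stronglyMeasurableAtFilter _ _) hc.continuousAt).add_const _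

theorem cdf_gaussianReal_pos (hv : v ≠ 0) (t : ℝ) : 0 < cdf (gaussianReal m v) t :=
  pos_of_hasDerivAt_of_tendsto_atBot (fun x _ => hasDerivAt_cdf_gaussianReal m hv x)
    (fun x _ => gaussianPDFReal_pos m v x hv) (tendsto_cdf_atBot _) (lt_add_one t)

/-- The sum of the two distribution values has zero derivative and limit `1` at `-∞`. The identity
turns `1 - F` into `F` at a reflected point, so every fact about the response `0` follows from the
one about the response `1`. -/
theorem cdf_gaussianReal_reflect (hv : v ≠ 0) (t : ℝ) :
    cdf (gaussianReal m v) (2 * m - t) = 1 - cdf (gaussianReal m v) t := by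
  set F := cdf (gaussianReal m v)
  have hd : ∀ t, HasDerivAt (fun t => F t + F (2 * m - t)) 0 t := by
    intro t
    have h1 := hasDerivAt_cdf_gaussianReal m hv t
    have h2 := (hasDerivAt_cdf_gaussianReal m hv (2 * m - t)).comp t
      ((hasDerivAt_id t).const_sub (2 * m))
    refine (h1.add h2).congr_deriv ?_
    have : gaussianPDFReal m v (2 * m - t) = gaussianPDFReal m v t := by
      unfold gaussianPDFReal
      congr 3
      ring
    rw [this]
    ring
  have hconst := is_const_of_deriv_eq_zero (fun t => (hd t).differentiableAt) fun t => (hd t).deriv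
  have hlim : Tendsto (fun t => F t + F (2 * m - t)) atBot (𝓝 (0 + 1)) := by
    refine (tendsto_cdf_atBot _).add ((tendsto_cdf_atTop _).comp ?_)
    exact tendsto_atTop_add_const_left _ _ tendsto_neg_atBot_atTop
  have hlim2 : Tendsto (fun t => F t + F (2 * m - t)) atBot (𝓝 (F t + F (2 * m - t))) :=
    tendsto_const_nhds.congr fun s => hconst t s
  have := tendsto_nhds_unique hlim hlim2
  linarith

/-- The integrated distribution function `∫_{-∞}^t F`. -/
noncomputable def gaussianIntegratedCDF (m : ℝ) (v : ℝ≥0) (t : ℝ) : ℝ :=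
  v * gaussianPDFReal m v t + (t - m) * cdf (gaussianReal m v) t

theorem hasDerivAt_gaussianIntegratedCDF (hv : v ≠ 0) (t : ℝ) :
    HasDerivAt (gaussianIntegratedCDF m v) (cdf (gaussianReal m v) t) t := by
  have hv' : (v : ℝ) ≠ 0 := by exact_mod_cast hv
  unfold gaussianIntegratedCDF
  refine (((hasDerivAt_gaussianPDFReal m hv t).const_mul (v : ℝ)).add
    (((hasDerivAt_id t).sub_const m).mul (hasDerivAt_cdf_gaussianReal m hv t))).congr_deriv ?_
  simp only [id]
  field_simp
  ring

theorem gaussianIntegratedCDF_pos (hv : v ≠ 0) (t : ℝ) : 0 < gaussianIntegratedCDF m v t := by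
  have hv' : (0 : ℝ) < v := by exact_mod_cast pos_iff_ne_zero.2 hv
  rcases le_or_gt m t with h | h
  · have h1 := gaussianPDFReal_pos m v t hv
    have h2 := cdf_gaussianReal_pos m hv t
    have h3 : 0 ≤ t - m := by linarith
    unfold gaussianIntegratedCDF
    positivity
  -- Mills' ratio bound: after division by `m - t` the distribution function cancels from the
  -- derivative, leaving the positive term `v f / (m - t)²`.
  · have key : 0 < v * gaussianPDFReal m v t / (m - t) - cdf (gaussianReal m v) t := by
      refine pos_of_hasDerivAt_of_tendsto_atBot
        (q := fun t => v * gaussianPDFReal m v t / (m - t) - cdf (gaussianReal m v) t)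
        (q' := fun t => v * gaussianPDFReal m v t / (m - t) ^ 2) (a := m) (fun t ht => ?_)
        (fun t ht => ?_) ?_ h
      · have hne : m - t ≠ 0 := by linarith
        refine ((((hasDerivAt_gaussianPDFReal m hv t).const_mul (v : ℝ)).div
          ((hasDerivAt_id t).const_sub m) hne).sub
          (hasDerivAt_cdf_gaussianReal m hv t)).congr_deriv ?_
        simp only [id]
        field_simp
        ring
      · have h1 := gaussianPDFReal_pos m v t hv
        have : 0 < m - t := by linarith
        positivity
      · have h1 : Tendsto (fun t => v * gaussianPDFReal m v t / (m - t)) atBot (𝓝 0) :=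
          Tendsto.div_atTop (a := v * 0) ((tendsto_gaussianPDFReal_atBot m hv).const_mul _)
            (tendsto_atTop_add_const_left _ _ tendsto_neg_atBot_atTop)
        simpa using h1.sub (tendsto_cdf_atBot (gaussianReal m v))
    have hne : 0 < m - t := by linarith
    have := mul_pos hne key
    unfold gaussianIntegratedCDF
    rw [mul_sub, mul_div_cancel₀ _ hne.ne'] at this
    linarith

theorem tendsto_mul_cdf_gaussianReal_atBot (hv : v ≠ 0) :
    Tendsto (fun t => (t - m) * cdf (gaussianReal m v) t) atBot (𝓝 0) := by
  have h := (tendsto_gaussianPDFReal_atBot m hv).const_mul (v : ℝ)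
  rw [mul_zero] at h
  refine squeeze_zero_norm' ?_ h
  filter_upwards [eventually_le_atBot m] with t ht
  have h1 := gaussianIntegratedCDF_pos m hv t
  unfold gaussianIntegratedCDF at h1
  rw [Real.norm_eq_abs, abs_of_nonpos]
  · linarith
  · exact mul_nonpos_of_nonpos_of_nonneg (by linarith) (cdf_nonneg _ _)

theorem tendsto_gaussianIntegratedCDF_atBot (hv : v ≠ 0) :
    Tendsto (gaussianIntegratedCDF m v) atBot (𝓝 0) := by
  have h := ((tendsto_gaussianPDFReal_atBot m hv).const_mul (v : ℝ)).add
    (tendsto_mul_cdf_gaussianReal_atBot m hv)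
  rw [mul_zero, zero_add] at h
  exact h

/-- For `t ≤ m` the integrated distribution function lies between `0` and `v f`, so the Gaussian
decay of `f` dominates. -/
theorem tendsto_mul_gaussianIntegratedCDF_atBot (hv : v ≠ 0) :
    Tendsto (fun t => (t - m) * gaussianIntegratedCDF m v t) atBot (𝓝 0) := by
  have h := ((tendsto_mul_gaussianPDFReal_atBot m hv).const_mul (v : ℝ)).norm
  rw [mul_zero, norm_zero] at h
  refine squeeze_zero_norm' ?_ h
  filter_upwards [eventually_le_atBot m] with t ht
  rw [Real.norm_eq_abs, Real.norm_eq_abs, mul_left_comm, abs_mul, abs_mul (t - m)]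
  refine mul_le_mul_of_nonneg_left ?_ (abs_nonneg _)
  rw [abs_of_pos (gaussianIntegratedCDF_pos m hv t)]
  refine le_trans ?_ (le_abs_self _)
  unfold gaussianIntegratedCDF
  have := mul_nonpos_of_nonpos_of_nonneg (by linarith : t - m ≤ 0)
    (cdf_nonneg (gaussianReal m v) t)
  linarith

/-- The variance of a Gaussian variable truncated to a half-line is nonnegative. -/
theorem gaussianPDFReal_mul_gaussianIntegratedCDF_lt (hv : v ≠ 0) (t : ℝ) :
    gaussianPDFReal m v t * gaussianIntegratedCDF m v t < cdf (gaussianReal m v) t ^ 2 := by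
  have hv' : (0 : ℝ) < v := by exact_mod_cast pos_iff_ne_zero.2 hv
  -- With `H` the integrated distribution function, `F + (t - m) H / v` is the derivative of `F² - f
  -- H` divided by `f`. Its own derivative is `2 H / v`, since `f + (t - m) F / v = H / v`.
  have hJ : ∀ t, 0 < cdf (gaussianReal m v) t + (t - m) * gaussianIntegratedCDF m v t / v := by
    intro t
    refine pos_of_hasDerivAt_of_tendsto_atBot
      (q := fun t => cdf (gaussianReal m v) t + (t - m) * gaussianIntegratedCDF m v t / v)
      (q' := fun t => 2 * gaussianIntegratedCDF m v t / v) (fun t _ => ?_) (fun t _ => ?_) ?_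
      (lt_add_one t)
    · refine ((hasDerivAt_cdf_gaussianReal m hv t).add ((((hasDerivAt_id t).sub_const m).mul
        (hasDerivAt_gaussianIntegratedCDF m hv t)).div_const (v : ℝ))).congr_deriv ?_
      simp only [id]
      field_simp
      simp only [gaussianIntegratedCDF]
      ring
    · have := gaussianIntegratedCDF_pos m hv t
      positivity
    · simpa using (tendsto_cdf_atBot (gaussianReal m v)).add
        ((tendsto_mul_gaussianIntegratedCDF_atBot m hv).div_const (v : ℝ))
  have hD : 0 < cdf (gaussianReal m v) t ^ 2
      - gaussianPDFReal m v t * gaussianIntegratedCDF m v t := by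
    refine pos_of_hasDerivAt_of_tendsto_atBot
      (q := fun t => cdf (gaussianReal m v) t ^ 2
        - gaussianPDFReal m v t * gaussianIntegratedCDF m v t)
      (q' := fun t => gaussianPDFReal m v t *
        (cdf (gaussianReal m v) t + (t - m) * gaussianIntegratedCDF m v t / v))
      (fun t _ => ?_) (fun t _ => mul_pos (gaussianPDFReal_pos m v t hv) (hJ t)) ?_ (lt_add_one t)
    · refine (((hasDerivAt_cdf_gaussianReal m hv t).pow 2).sub
        ((hasDerivAt_gaussianPDFReal m hv t).mul
          (hasDerivAt_gaussianIntegratedCDF m hv t))).congr_deriv ?_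
      simp
      ring
    · simpa using ((tendsto_cdf_atBot (gaussianReal m v)).pow 2).sub
        ((tendsto_gaussianPDFReal_atBot m hv).mul (tendsto_gaussianIntegratedCDF_atBot m hv))
  linarith

/-- The derivative of `log F`. -/
noncomputable def gaussianHazard (m : ℝ) (v : ℝ≥0) (t : ℝ) : ℝ :=
  gaussianPDFReal m v t / cdf (gaussianReal m v) t

/-- The second derivative of `log F`. -/
noncomputable def gaussianHazardDeriv (m : ℝ) (v : ℝ≥0) (t : ℝ) : ℝ :=
  -(gaussianPDFReal m v t * gaussianIntegratedCDF m v t) / (v * cdf (gaussianReal m v) t ^ 2)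

theorem hasDerivAt_log_cdf_gaussianReal (hv : v ≠ 0) (t : ℝ) :
    HasDerivAt (fun t => Real.log (cdf (gaussianReal m v) t)) (gaussianHazard m v t) t :=
  (hasDerivAt_cdf_gaussianReal m hv t).log (cdf_gaussianReal_pos m hv t).ne'

/-- As `f' = -(t - m) f / v`, the numerator `f' F - f²` of the quotient rule is `-f H / v`, with `H`
the integrated distribution function. Positivity of `H` thus gives strict concavity of `log F`, and
`f H < F²` bounds the curvature by `1 / v`. -/
theorem hasDerivAt_gaussianHazard (hv : v ≠ 0) (t : ℝ) :
    HasDerivAt (gaussianHazard m v) (gaussianHazardDeriv m v t) t := by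
  have hv' : (v : ℝ) ≠ 0 := by exact_mod_cast hv
  have hF := (cdf_gaussianReal_pos m hv t).ne'
  refine ((hasDerivAt_gaussianPDFReal m hv t).div (hasDerivAt_cdf_gaussianReal m hv t)
    hF).congr_deriv ?_
  unfold gaussianHazardDeriv gaussianIntegratedCDF
  field_simp
  ring

theorem gaussianHazardDeriv_neg (hv : v ≠ 0) (t : ℝ) : gaussianHazardDeriv m v t < 0 := by
  have hv' : (0 : ℝ) < v := by exact_mod_cast pos_iff_ne_zero.2 hv
  have hF := cdf_gaussianReal_pos m hv t
  refine div_neg_of_neg_of_pos (neg_lt_zero.2 ?_) (by positivity)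
  exact mul_pos (gaussianPDFReal_pos m v t hv) (gaussianIntegratedCDF_pos m hv t)

theorem gaussianHazardDeriv_ge (hv : v ≠ 0) (t : ℝ) :
    -(1 / (v : ℝ)) ≤ gaussianHazardDeriv m v t := by
  have hv' : (0 : ℝ) < v := by exact_mod_cast pos_iff_ne_zero.2 hv
  have hF := cdf_gaussianReal_pos m hv t
  have h := gaussianPDFReal_mul_gaussianIntegratedCDF_lt m hv t
  unfold gaussianHazardDeriv
  rw [neg_div, neg_le_neg_iff, div_le_div_iff₀ (by positivity) hv']
  nlinarith

theorem continuous_gaussianHazardDeriv (hv : v ≠ 0) : Continuous (gaussianHazardDeriv m v) := by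
  have hv' : (0 : ℝ) < v := by exact_mod_cast pos_iff_ne_zero.2 hv
  have hF : Continuous (cdf (gaussianReal m v)) :=
    continuous_iff_continuousAt.2 fun t => (hasDerivAt_cdf_gaussianReal m hv t).continuousAt
  have hH : Continuous (gaussianIntegratedCDF m v) :=
    continuous_iff_continuousAt.2 fun t => (hasDerivAt_gaussianIntegratedCDF m hv t).continuousAt
  refine ((continuous_gaussianPDFReal m v).mul hH).neg.div (by fun_prop) fun t => ?_
  have := cdf_gaussianReal_pos m hv t
  positivity

/-- This is `F ((log F)'' + ((log F)')²) = F''`. The two responses have opposite `F''`, which yields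
the field `info`. -/
theorem cdf_mul_gaussianHazardDeriv_add_sq (hv : v ≠ 0) (t : ℝ) :
    cdf (gaussianReal m v) t * (gaussianHazardDeriv m v t + gaussianHazard m v t ^ 2) =
      -((t - m) / v) * gaussianPDFReal m v t := by
  have hv' : (v : ℝ) ≠ 0 := by exact_mod_cast hv
  have hF := (cdf_gaussianReal_pos m hv t).ne'
  unfold gaussianHazardDeriv gaussianIntegratedCDF gaussianHazard
  field_simp
  ring

/-- The probability of the binary response `s` when the threshold is at `t`. -/
noncomputable def responseProb (F : ℝ → ℝ) (s : ℕ) (t : ℝ) : ℝ := if s = 1 then F t else 1 - F t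

/-- The derivative of the log-probability of the response `s`. -/
noncomputable def responseScore (m : ℝ) (v : ℝ≥0) (s : ℕ) (t : ℝ) : ℝ :=
  if s = 1 then gaussianHazard m v t else -gaussianHazard m v (2 * m - t)

/-- The second derivative of the log-probability of the response `s`. -/
noncomputable def responseCurvature (m : ℝ) (v : ℝ≥0) (s : ℕ) (t : ℝ) : ℝ :=
  if s = 1 then gaussianHazardDeriv m v t else gaussianHazardDeriv m v (2 * m - t)

theorem isRegularLink_gaussian (hv : v ≠ 0) :
    IsRegularLink (responseProb (cdf (gaussianReal m v))) (responseScore m v)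
      (responseCurvature m v) (1 / v) where
  pos s t := by
    unfold responseProb
    split_ifs
    · exact cdf_gaussianReal_pos m hv t
    · rw [← cdf_gaussianReal_reflect m hv]
      exact cdf_gaussianReal_pos m hv _
  sum_one t := by simp [responseProb]
  hasDerivAt_log s t := by
    unfold responseProb responseScore
    split_ifs
    · exact hasDerivAt_log_cdf_gaussianReal m hv t
    · simp_rw [← cdf_gaussianReal_reflect m hv]
      exact ((hasDerivAt_log_cdf_gaussianReal m hv (2 * m - t)).comp t
        ((hasDerivAt_id t).const_sub (2 * m))).congr_deriv (by ring)
  hasDerivAt_score s t := by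
    unfold responseScore responseCurvature
    by_cases hs : s = 1
    · simp only [hs, if_true]
      exact hasDerivAt_gaussianHazard m hv t
    · simp only [hs, if_false]
      exact ((hasDerivAt_gaussianHazard m hv (2 * m - t)).comp t
        ((hasDerivAt_id t).const_sub (2 * m))).neg.congr_deriv (by ring)
  neg s t := by
    unfold responseCurvature
    split_ifs <;> exact gaussianHazardDeriv_neg m hv _
  lower s t := by
    unfold responseCurvature
    split_ifs <;> exact gaussianHazardDeriv_ge m hv _
  cont s := by
    have := continuous_gaussianHazardDeriv m hv
    unfold responseCurvature
    split_ifs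
    · exact this
    · exact this.comp (by fun_prop)
  sum_score t := by
    have h1 := (cdf_gaussianReal_pos m hv t).ne'
    have h2 := (cdf_gaussianReal_pos m hv (2 * m - t)).ne'
    have h3 : gaussianPDFReal m v (2 * m - t) = gaussianPDFReal m v t := by
      unfold gaussianPDFReal
      congr 3
      ring
    simp only [responseProb, responseScore, if_true, zero_ne_one, if_false,
      ← cdf_gaussianReal_reflect m hv, gaussianHazard, h3]
    field_simp
    ring
  info t := by
    have h1 := cdf_mul_gaussianHazardDeriv_add_sq m hv t
    have h2 := cdf_mul_gaussianHazardDeriv_add_sq m hv (2 * m - t)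
    have h3 : gaussianPDFReal m v (2 * m - t) = gaussianPDFReal m v t := by
      unfold gaussianPDFReal
      congr 3
      ring
    simp only [responseProb, responseScore, responseCurvature, if_true, zero_ne_one, if_false,
      ← cdf_gaussianReal_reflect m hv, neg_sq]
    rw [h1, h2, h3]
    ring

end Gaussian

/-! ### Maximizers of concave functions -/

section Concave

variable {E : Type*} [NormedAddCommGroup E] [NormedSpace ℝ E]

theorem exists_mem_segment_mem_sphere {x z : E} {r : ℝ} (hr : 0 < r) (hz : r ≤ dist z x) :
    ∃ y ∈ Metric.sphere x r, y ∈ segment ℝ x z := by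
  have hd : 0 < dist z x := hr.trans_le hz
  refine ⟨AffineMap.lineMap x z (r / dist z x), ?_, ?_⟩
  · rw [Metric.mem_sphere, dist_lineMap_left, Real.norm_eq_abs, abs_of_pos (by positivity),
      dist_comm x z, div_mul_cancel₀ _ hd.ne']
  · rw [segment_eq_image_lineMap]
    exact ⟨_, ⟨by positivity, (div_le_one hd).2 hz⟩, rfl⟩

/-- The segment from the centre to `z` crosses the sphere, and there a concave function is at least
the minimum of its two end values. -/
theorem le_of_concaveOn_of_forall_sphere_le {f : E → ℝ} (hf : ConcaveOn ℝ Set.univ f) {x₀ z : E}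
    {r c : ℝ} (hr : 0 < r) (hsphere : ∀ y ∈ Metric.sphere x₀ r, f y ≤ c) (hc : c < f x₀)
    (hz : r ≤ dist z x₀) : f z ≤ c := by
  by_contra! hlt
  obtain ⟨y, hys, hmem⟩ := exists_mem_segment_mem_sphere hr hz
  have h1 := hf.ge_on_segment (Set.mem_univ x₀) (Set.mem_univ z) hmem
  have h2 := hsphere y hys
  have h3 : c < min (f x₀) (f z) := lt_min hc hlt
  linarith

theorem lt_of_strictConcaveOn_of_isMaxOn {f : E → ℝ} (hf : StrictConcaveOn ℝ Set.univ f)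
    {x y : E} (hx : IsMaxOn f Set.univ x) (hxy : y ≠ x) : f y < f x := by
  refine lt_of_le_of_ne (hx (Set.mem_univ y)) fun h => hxy ?_
  refine hf.eq_of_isMaxOn (fun z hz => ?_) hx (Set.mem_univ _) (Set.mem_univ _)
  change f z ≤ f y
  rw [h]
  exact hx hz

variable [ProperSpace E]

/-- On a sphere around the maximizer compactness gives a value strictly below the maximum, and
concavity carries this bound to the whole exterior. An empty sphere occurs only in the trivial
space. -/
theorem tendsto_of_strictConcaveOn_of_tendsto_max {f : E → ℝ}
    (hf : StrictConcaveOn ℝ Set.univ f) (hcont : Continuous f) {x : E}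
    (hx : IsMaxOn f Set.univ x) {u : ℕ → E}
    (hu : Tendsto (fun k => f (u k)) atTop (𝓝 (f x))) : Tendsto u atTop (𝓝 x) := by
  rw [Metric.tendsto_nhds]
  intro ε hε
  by_cases hne : (Metric.sphere x ε).Nonempty
  · obtain ⟨y, hy, hmax⟩ := (isCompact_sphere x ε).exists_isMaxOn hne hcont.continuousOn
    have hlt : f y < f x := lt_of_strictConcaveOn_of_isMaxOn hf hx
      (ne_of_mem_of_not_mem hy (by simp [hε.ne]))
    filter_upwards [hu.eventually_const_lt hlt] with k hk
    by_contra! hge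
    exact absurd (le_of_concaveOn_of_forall_sphere_le hf.concaveOn hε (fun z hz => hmax hz) hlt
      hge) (not_le.2 hk)
  · refine Eventually.of_forall fun k => ?_
    by_contra! hge
    obtain ⟨y, hys, -⟩ := exists_mem_segment_mem_sphere hε hge
    exact hne ⟨y, hys⟩

/-- The maximizer of a strictly concave function which depends measurably on a parameter is a
measurable function of the parameter. -/
theorem exists_measurable_argmax [MeasurableSpace E] [BorelSpace E]
    {Y : Type*} [MeasurableSpace Y] (ψ : Y → E → ℝ)
    (hmeas : ∀ q, Measurable fun y => ψ y q) (hcont : ∀ y, Continuous (ψ y))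
    (hbdd : ∀ y q, ψ y q ≤ 0) :
    ∃ Θ : Y → E, Measurable Θ ∧ ∀ y, StrictConcaveOn ℝ Set.univ (ψ y) →
      ∀ x, IsMaxOn (ψ y) Set.univ x → Θ y = x := by
  classical
  have : SecondCountableTopology E := secondCountable_of_proper
  have : CompleteSpace E := inferInstance
  let q : ℕ → E := TopologicalSpace.denseSeq E
  have hex : ∀ (k : ℕ) (y : Y), ∃ j, ∀ i, ψ y (q i) ≤ ψ y (q j) + 1 / ((k : ℝ) + 1) := by
    intro k y
    have hb : BddAbove (Set.range fun i => ψ y (q i)) := ⟨0, by rintro _ ⟨i, rfl⟩; exact hbdd _ _⟩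
    obtain ⟨j, hj⟩ := exists_lt_of_lt_ciSup
      (show (⨆ i, ψ y (q i)) - 1 / ((k : ℝ) + 1) < ⨆ i, ψ y (q i) by
        have : 0 < 1 / ((k : ℝ) + 1) := Nat.one_div_pos_of_nat
        linarith)
    exact ⟨j, fun i => by linarith [le_ciSup hb i]⟩
  -- The first point of a dense sequence that is optimal along that sequence up to `1 / (k + 1)`;
  -- taking the least index makes the choice measurable.
  let T : ℕ → Y → E := fun k y => q (Nat.find (hex k y))
  have hT : ∀ k, Measurable (T k) := by
    intro k
    refine (measurable_from_top (f := q)).comp (measurable_find (hex k) fun j => ?_)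
    simp only [Set.ofPred_forall]
    exact MeasurableSet.iInter fun i =>
      measurableSet_le (hmeas _) ((hmeas _).add_const _)
  -- `limUnder` is measurable everywhere; its value matters only where the near-maximizers converge.
  refine ⟨fun y => limUnder atTop fun k => T k y, ?_, fun y hsc x hx => ?_⟩
  · exact (StronglyMeasurable.limUnder fun k => (hT k).stronglyMeasurable).measurable
  · refine Tendsto.limUnder_eq (tendsto_of_strictConcaveOn_of_tendsto_max hsc (hcont y) hx ?_)
    have hle : ∀ k : ℕ, ψ y x ≤ ψ y (T k y) + 1 / ((k : ℝ) + 1) := by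
      intro k
      have hclosed : IsClosed {z | ψ y z ≤ ψ y (T k y) + 1 / ((k : ℝ) + 1)} :=
        isClosed_le (hcont y) continuous_const
      have hdense : Dense {z | ψ y z ≤ ψ y (T k y) + 1 / ((k : ℝ) + 1)} :=
        (TopologicalSpace.denseRange_denseSeq E).mono <| by
          rintro _ ⟨i, rfl⟩
          exact Nat.find_spec (hex k y) i
      have := hclosed.closure_eq.symm.trans hdense.closure_eq
      exact (Set.ext_iff.1 this x).2 (Set.mem_univ x)
    have hlim : Tendsto (fun k : ℕ => ψ y x - 1 / ((k : ℝ) + 1)) atTop (𝓝 (ψ y x)) := by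
      simpa using (tendsto_const_nhds (x := ψ y x)).sub
        (tendsto_one_div_add_atTop_nhds_zero_nat (𝕜 := ℝ))
    exact tendsto_of_tendsto_of_tendsto_of_le_of_le hlim tendsto_const_nhds
      (fun k => by simpa using hle k) fun k => hx (Set.mem_univ _)

end Concave

/-! ### Zeros of the gradients of a sequence of concave functions -/

section Gradient

variable {E : Type*} [NormedAddCommGroup E] [InnerProductSpace ℝ E]

/-- At a zero of `S N` the linearization reads `Λ (x N - θ) ≈ N⁻¹ S N θ`, and `Λ'` inverts it. The
error is relative to the leading term, so no rate of convergence of `x N` is required. -/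
theorem eventually_norm_sub_le_of_linearization {S : ℕ → E → E} {θ : E} {Λ Λ' : E →L[ℝ] E}
    (hΛ : ∀ u, Λ' (Λ u) = u)
    (hlin : ∀ κ > 0, ∃ δ > 0, ∀ᶠ N : ℕ in atTop, ∀ x ∈ Metric.closedBall θ δ,
      ‖(N : ℝ)⁻¹ • S N x - ((N : ℝ)⁻¹ • S N θ - Λ (x - θ))‖ ≤ κ * ‖x - θ‖)
    {x : ℕ → E} (hx : Tendsto x atTop (𝓝 θ)) (hzero : ∀ᶠ N in atTop, S N (x N) = 0)
    {κ : ℝ} (hκ : 0 < κ) :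
    ∀ᶠ N : ℕ in atTop, ‖(x N - θ) - Λ' ((N : ℝ)⁻¹ • S N θ)‖ ≤
      κ * ‖Λ' ((N : ℝ)⁻¹ • S N θ)‖ := by
  set B := ‖Λ'‖ + 1 with hB
  have hB0 : 0 < B := by positivity
  -- The bound `1 / 2` absorbs `‖u‖` and gives `‖u‖ ≤ 2 ‖Λ' w‖`; the bound `κ / 2` compensates this
  -- factor `2`.
  set τ := min (1 / 2) (κ / 2) with hτ
  have hτ0 : 0 < τ := lt_min (by norm_num) (by positivity)
  obtain ⟨δ, hδ, hev⟩ := hlin (τ / B) (by positivity)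
  filter_upwards [hev, hzero, hx (Metric.closedBall_mem_nhds θ hδ)] with N h1 h2 h3
  set w := (N : ℝ)⁻¹ • S N θ with hw
  set u := x N - θ with hu
  have h4 := h1 (x N) h3
  rw [h2, smul_zero, zero_sub, neg_sub] at h4
  have h5 : ‖u - Λ' w‖ ≤ τ * ‖u‖ := by
    calc ‖u - Λ' w‖ = ‖Λ' (Λ u - w)‖ := by rw [map_sub, hΛ]
      _ ≤ ‖Λ'‖ * ‖Λ u - w‖ := Λ'.le_opNorm _
      _ ≤ B * (τ / B * ‖u‖) := by
        refine mul_le_mul (by rw [hB]; linarith) h4 (norm_nonneg _) hB0.le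
      _ = τ * ‖u‖ := by field_simp
  have h6 : ‖u‖ ≤ 2 * ‖Λ' w‖ := by
    have h7 : ‖u‖ ≤ ‖u - Λ' w‖ + ‖Λ' w‖ := by
      simpa using norm_add_le (u - Λ' w) (Λ' w)
    have h8 : τ * ‖u‖ ≤ 1 / 2 * ‖u‖ := mul_le_mul_of_nonneg_right (min_le_left _ _) (norm_nonneg _)
    linarith
  calc ‖u - Λ' w‖ ≤ τ * ‖u‖ := h5
    _ ≤ κ / 2 * (2 * ‖Λ' w‖) := mul_le_mul (min_le_right _ _) h6 (norm_nonneg _) (by positivity)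
    _ = κ * ‖Λ' w‖ := by ring

variable [CompleteSpace E]

theorem exists_isMaxOn_of_concaveOn_of_inner_gradient_neg [ProperSpace E] {f : E → ℝ} {f' : E → E}
    (hf : ConcaveOn ℝ Set.univ f) (hgrad : ∀ x, HasGradientAt f (f' x) x) {x₀ : E} {r : ℝ}
    (hr : 0 < r) (hsphere : ∀ y ∈ Metric.sphere x₀ r, ⟪f' y, y - x₀⟫ < 0) :
    ∃ x ∈ Metric.closedBall x₀ r, IsMaxOn f Set.univ x := by
  have hcont : Continuous f :=
    continuous_iff_continuousAt.2 fun x => (hgrad x).continuousAt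
  obtain ⟨x, hx, hmax⟩ := (isCompact_closedBall x₀ r).exists_isMaxOn
    ⟨x₀, Metric.mem_closedBall_self hr.le⟩ hcont.continuousOn
  refine ⟨x, hx, ?_⟩
  rcases (Metric.mem_closedBall.1 hx).lt_or_eq with h | h
  -- An interior maximum is local, hence global by concavity. A maximum on the sphere would have a
  -- nonpositive derivative towards the centre, against the inward-pointing gradient.
  · have hloc : IsLocalMax f x := hmax.isLocalMax (Metric.closedBall_mem_nhds_of_mem h)
    exact fun z _ => IsMaxOn.of_isLocalMax_of_convex_univ hloc hf z
  · exfalso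
    have hseg : segment ℝ x x₀ ⊆ Metric.closedBall x₀ r :=
      (convex_closedBall x₀ r).segment_subset hx (Metric.mem_closedBall_self hr.le)
    have h1 := hmax.localize.hasFDerivWithinAt_nonpos
      (hgrad x).hasFDerivAt.hasFDerivWithinAt
      (sub_mem_posTangentConeAt_of_segment_subset hseg)
    rw [InnerProductSpace.toDual_apply_apply, ← neg_sub x x₀, inner_neg_right] at h1
    linarith [hsphere x h]

theorem eventually_exists_isMaxOn_of_linearization [ProperSpace E] {f : ℕ → E → ℝ}
    {S : ℕ → E → E} {θ : E} {Λ : E →L[ℝ] E} {c : ℝ} (hc : 0 < c)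
    (hΛ : ∀ u, c * ‖u‖ ^ 2 ≤ ⟪Λ u, u⟫)
    (hf : ∀ N, ConcaveOn ℝ Set.univ (f N)) (hgrad : ∀ N x, HasGradientAt (f N) (S N x) x)
    (hzero : Tendsto (fun N : ℕ => (N : ℝ)⁻¹ • S N θ) atTop (𝓝 0))
    (hlin : ∀ κ > 0, ∃ δ > 0, ∀ᶠ N : ℕ in atTop, ∀ x ∈ Metric.closedBall θ δ,
      ‖(N : ℝ)⁻¹ • S N x - ((N : ℝ)⁻¹ • S N θ - Λ (x - θ))‖ ≤ κ * ‖x - θ‖)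
    {ε : ℝ} (hε : 0 < ε) :
    ∀ᶠ N : ℕ in atTop, ∃ x ∈ Metric.closedBall θ ε, IsMaxOn (f N) Set.univ x := by
  -- On the sphere of radius `r` the linearization error and the score at `θ` each contribute at
  -- most `c r² / 4` to the radial derivative, against at least `c r²` from `Λ`.
  obtain ⟨δ, hδ, hev⟩ := hlin (c / 4) (by positivity)
  set r := min δ ε with hr
  have hr0 : 0 < r := lt_min hδ hε
  have hsmall : ∀ᶠ N : ℕ in atTop, ‖(N : ℝ)⁻¹ • S N θ‖ < c / 4 * r := by
    have := hzero.norm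
    rw [norm_zero] at this
    exact this.eventually_lt_const (by positivity)
  filter_upwards [hev, hsmall, eventually_gt_atTop 0] with N h1 h2 hN
  obtain ⟨x, hx, hmax⟩ := exists_isMaxOn_of_concaveOn_of_inner_gradient_neg (hf N) (hgrad N) hr0
    (x₀ := θ) fun y hy => by
      have hyr : ‖y - θ‖ = r := by rwa [Metric.mem_sphere, dist_eq_norm] at hy
      have h3 := h1 y (by rw [Metric.mem_closedBall, dist_eq_norm, hyr]; exact min_le_left _ _)
      rw [hyr] at h3
      have h4 : ⟪(N : ℝ)⁻¹ • S N y, y - θ⟫ =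
          ⟪(N : ℝ)⁻¹ • S N y - ((N : ℝ)⁻¹ • S N θ - Λ (y - θ)), y - θ⟫ +
            ⟪(N : ℝ)⁻¹ • S N θ, y - θ⟫ - ⟪Λ (y - θ), y - θ⟫ := by
        simp only [inner_sub_left]
        ring
      have h5 := (real_inner_le_norm
        ((N : ℝ)⁻¹ • S N y - ((N : ℝ)⁻¹ • S N θ - Λ (y - θ))) (y - θ)).trans
        (mul_le_mul_of_nonneg_right h3 (norm_nonneg _))
      have h6 := (real_inner_le_norm ((N : ℝ)⁻¹ • S N θ) (y - θ)).trans
        (mul_le_mul_of_nonneg_right h2.le (norm_nonneg _))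
      have h7 := hΛ (y - θ)
      rw [hyr] at h5 h6 h7
      have h8 : ⟪(N : ℝ)⁻¹ • S N y, y - θ⟫ < 0 := by
        have : 0 < c * r ^ 2 := by positivity
        rw [h4]
        nlinarith
      rw [real_inner_smul_left] at h8
      have hN' : (0 : ℝ) < (N : ℝ)⁻¹ := by positivity
      exact (pos_iff_neg_of_mul_neg h8).1 hN'
  exact ⟨x, Metric.closedBall_subset_closedBall (min_le_right _ _) hx, hmax⟩

end Gradient

/-! ### The log-likelihood of a binary response model -/

section Likelihood

variable {n : ℕ} {p g h : ℕ → ℝ → ℝ} {K : ℝ} (C : ℝ) (φ : ℕ → EuclideanSpace ℝ (Fin n))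
  (s : ℕ → ℕ) (N : ℕ)

/-- The log-likelihood of a binary response model with response probabilities `p`. -/
noncomputable def linkLogLikelihood (p : ℕ → ℝ → ℝ) (γ : EuclideanSpace ℝ (Fin n)) : ℝ :=
  ∑ i ∈ Finset.range N, Real.log (p (s i) (C - ⟪φ i, γ⟫))

/-- The gradient of the log-likelihood, in terms of the derivatives `g` of the
log-probabilities. -/
noncomputable def linkScore (g : ℕ → ℝ → ℝ) (γ : EuclideanSpace ℝ (Fin n)) :
    EuclideanSpace ℝ (Fin n) :=
  ∑ i ∈ Finset.range N, (-g (s i) (C - ⟪φ i, γ⟫)) • φ i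

variable {C φ s N}

theorem hasGradientAt_log_link (hl : IsRegularLink p g h K) (C : ℝ) (s : ℕ)
    (x γ : EuclideanSpace ℝ (Fin n)) :
    HasGradientAt (fun γ => Real.log (p s (C - ⟪x, γ⟫))) ((-g s (C - ⟪x, γ⟫)) • x) γ := by
  rw [hasGradientAt_iff_hasFDerivAt]
  have h1 : HasFDerivAt (fun γ => C - ⟪x, γ⟫) (-(innerSL ℝ x)) γ :=
    ((innerSL ℝ x).hasFDerivAt).const_sub C
  refine ((hl.hasDerivAt_log s (C - ⟪x, γ⟫)).comp_hasFDerivAt γ h1).congr_fderiv ?_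
  ext y
  simp [InnerProductSpace.toDual_apply_apply]

theorem hasGradientAt_linkLogLikelihood (hl : IsRegularLink p g h K)
    (γ : EuclideanSpace ℝ (Fin n)) :
    HasGradientAt (linkLogLikelihood C φ s N p) (linkScore C φ s N g γ) γ := by
  rw [hasGradientAt_iff_hasFDerivAt]
  unfold linkLogLikelihood linkScore
  rw [map_sum]
  exact HasFDerivAt.fun_sum fun i _ => (hasGradientAt_log_link hl C (s i) (φ i) γ).hasFDerivAt

theorem strictConcaveOn_log_link (hl : IsRegularLink p g h K) (s : ℕ) :
    StrictConcaveOn ℝ Set.univ fun t => Real.log (p s t) := by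
  have hd : deriv (fun t => Real.log (p s t)) = g s := funext fun t => (hl.hasDerivAt_log s t).deriv
  refine StrictAnti.strictConcaveOn_univ_of_deriv
    (continuous_iff_continuousAt.2 fun t => (hl.hasDerivAt_log s t).continuousAt) ?_
  rw [hd]
  refine strictAnti_of_deriv_neg fun t => ?_
  rw [(hl.hasDerivAt_score s t).deriv]
  exact hl.neg s t

theorem concaveOn_linkLogLikelihood (hl : IsRegularLink p g h K) :
    ConcaveOn ℝ Set.univ (linkLogLikelihood C φ s N p) := by
  refine ⟨convex_univ, fun x _ y _ a b ha hb hab => ?_⟩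
  simp only [linkLogLikelihood, smul_eq_mul, Finset.mul_sum, ← Finset.sum_add_distrib]
  refine Finset.sum_le_sum fun i _ => ?_
  have := (strictConcaveOn_log_link hl (s i)).concaveOn.2 (Set.mem_univ (C - ⟪φ i, x⟫))
    (Set.mem_univ (C - ⟪φ i, y⟫)) ha hb hab
  simp only [smul_eq_mul] at this
  refine this.trans (le_of_eq ?_)
  congr 2
  rw [inner_add_right, real_inner_smul_right, real_inner_smul_right]
  linear_combination C * hab

theorem strictConcaveOn_linkLogLikelihood (hl : IsRegularLink p g h K)
    (hexc : ∀ u ≠ 0, ∃ i < N, ⟪φ i, u⟫ ≠ 0) :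
    StrictConcaveOn ℝ Set.univ (linkLogLikelihood C φ s N p) := by
  refine ⟨convex_univ, fun x _ y _ hxy a b ha hb hab => ?_⟩
  obtain ⟨j, hj, hjne⟩ := hexc (x - y) (sub_ne_zero.2 hxy)
  simp only [linkLogLikelihood, smul_eq_mul, Finset.mul_sum, ← Finset.sum_add_distrib]
  have hrw : ∀ i, C - ⟪φ i, a • x + b • y⟫ = a * (C - ⟪φ i, x⟫) + b * (C - ⟪φ i, y⟫) := by
    intro i
    rw [inner_add_right, real_inner_smul_right, real_inner_smul_right]
    linear_combination (-C) * hab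
  simp only [hrw]
  refine Finset.sum_lt_sum (fun i _ => ?_) ⟨j, Finset.mem_range.2 hj, ?_⟩
  · exact (strictConcaveOn_log_link hl (s i)).concaveOn.2 (Set.mem_univ _)
      (Set.mem_univ _) ha.le hb.le hab
  · refine (strictConcaveOn_log_link hl (s j)).2 (Set.mem_univ _) (Set.mem_univ _) ?_ ha hb hab
    intro heq
    rw [inner_sub_right] at hjne
    exact hjne (by linarith)

/-- The one-observation information `-h • φ φᵀ`. -/
noncomputable def linkInfo (h : ℕ → ℝ → ℝ) (C : ℝ) (θ : EuclideanSpace ℝ (Fin n))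
    (z : EuclideanSpace ℝ (Fin n) × ℕ) : EuclideanSpace ℝ (Fin n) →L[ℝ] EuclideanSpace ℝ (Fin n) :=
  (-h z.2 (C - ⟪z.1, θ⟫)) • (innerSL ℝ z.1).smulRight z.1

theorem norm_linkScore_sub_le (hl : IsRegularLink p g h K) {θ γ : EuclideanSpace ℝ (Fin n)}
    {δ : ℝ} {e : ℕ → ℝ}
    (he : ∀ i ξ, |ξ - (C - ⟪φ i, θ⟫)| ≤ δ * ‖φ i‖ →
      |h (s i) ξ - h (s i) (C - ⟪φ i, θ⟫)| * ‖φ i‖ ^ 2 ≤ e i) (hγ : γ ∈ Metric.closedBall θ δ) :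
    ‖linkScore C φ s N g γ - linkScore C φ s N g θ +
      (∑ i ∈ Finset.range N, linkInfo h C θ (φ i, s i)) (γ - θ)‖ ≤
      (∑ i ∈ Finset.range N, e i) * ‖γ - θ‖ := by
  rw [Metric.mem_closedBall, dist_eq_norm] at hγ
  simp only [linkScore, linkInfo, sum_apply, ← Finset.sum_sub_distrib,
    ← Finset.sum_add_distrib, Finset.sum_mul]
  refine norm_sum_le_of_le _ fun i _ => ?_
  simp only [smul_apply, ContinuousLinearMap.smulRight_apply,
    innerSL_apply_apply, smul_smul, ← sub_smul, ← add_smul]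
  rw [norm_smul, Real.norm_eq_abs]
  set t := C - ⟪φ i, θ⟫ with ht
  set r := ⟪φ i, γ - θ⟫ with hr
  have hr' : |r| ≤ ‖φ i‖ * ‖γ - θ‖ := abs_real_inner_le_norm _ _
  have ht' : C - ⟪φ i, γ⟫ = t - r := by rw [ht, hr, inner_sub_right]; ring
  rw [ht']
  -- Mean value theorem for one scalar term, split by the sign of the displacement `r`.
  obtain ⟨ξ, hξ, hval⟩ : ∃ ξ, |ξ - t| ≤ |r| ∧ g (s i) (t - r) - g (s i) t = h (s i) ξ * (-r) := by
    have hd := fun x => hl.hasDerivAt_score (s i) x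
    have hc : Continuous (g (s i)) := continuous_iff_continuousAt.2 fun x => (hd x).continuousAt
    rcases lt_trichotomy r 0 with hr0 | hr0 | hr0
    · obtain ⟨ξ, hξ, hval⟩ := exists_hasDerivAt_eq_slope (g (s i)) (h (s i))
        (show t < t - r by linarith) hc.continuousOn fun x _ => hd x
      refine ⟨ξ, ?_, ?_⟩
      · rw [abs_of_neg hr0, abs_le]
        constructor <;> linarith [hξ.1, hξ.2]
      · have : t - r - t ≠ 0 := by linarith
        rw [hval]
        field_simp
        ring
    · exact ⟨t, by simp, by simp [hr0]⟩
    · obtain ⟨ξ, hξ, hval⟩ := exists_hasDerivAt_eq_slope (g (s i)) (h (s i))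
        (show t - r < t by linarith) hc.continuousOn fun x _ => hd x
      refine ⟨ξ, ?_, ?_⟩
      · rw [abs_of_pos hr0, abs_le]
        constructor <;> linarith [hξ.1, hξ.2]
      · have : t - (t - r) ≠ 0 := by linarith
        rw [hval]
        field_simp
        ring
  have h1 : -g (s i) (t - r) - -g (s i) t + -h (s i) t * r = (h (s i) ξ - h (s i) t) * r := by
    linear_combination -hval
  have h2 := he i ξ (hξ.trans (hr'.trans (by
    rw [mul_comm]; exact mul_le_mul_of_nonneg_right hγ (norm_nonneg _))))
  rw [h1, abs_mul]
  calc |h (s i) ξ - h (s i) t| * |r| * ‖φ i‖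
      ≤ |h (s i) ξ - h (s i) t| * (‖φ i‖ * ‖γ - θ‖) * ‖φ i‖ := by gcongr
    _ = |h (s i) ξ - h (s i) t| * ‖φ i‖ ^ 2 * ‖γ - θ‖ := by ring
    _ ≤ e i * ‖γ - θ‖ := by gcongr

theorem inner_ne_zero_of_excitation_posDef (hA : (excitation φ N).PosDef)
    {u : EuclideanSpace ℝ (Fin n)} (hu : u ≠ 0) : ∃ i < N, ⟪φ i, u⟫ ≠ 0 := by
  by_contra! hzero
  have h1 := hA.dotProduct_mulVec_pos (x := u.ofLp) (by simpa using hu)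
  have h2 : (excitation φ N).mulVec u.ofLp = 0 := by
    rw [excitation, Matrix.sum_mulVec]
    refine Finset.sum_eq_zero fun i hi => ?_
    rw [Matrix.vecMulVec_mulVec]
    have h3 : (φ i).ofLp ⬝ᵥ u.ofLp = 0 := by
      rw [← hzero i (Finset.mem_range.1 hi)]
      simp [PiLp.inner_apply, dotProduct, mul_comm]
    rw [h3]
    simp
  rw [h2] at h1
  simp at h1

end Likelihood

/-! ### Limit theorems -/

section Limits

variable {Ω : Type*} [MeasurableSpace Ω] {μ : Measure Ω}

theorem exists_measurable_index {G : ℕ → Set Ω} (hG : ∀ N, MeasurableSet (G N))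
    (hev : ∀ᵐ ω ∂μ, ∀ᶠ N in atTop, ω ∈ G N) :
    ∃ n₀ : Ω → ℕ, Measurable n₀ ∧ ∀ᵐ ω ∂μ, ∀ N, n₀ ω ≤ N → ω ∈ G N := by
  classical
  have hmeas : ∀ M, MeasurableSet {ω | ∀ N, M ≤ N → ω ∈ G N} := by
    intro M
    simp only [Set.ofPred_forall]
    exact MeasurableSet.iInter fun N => MeasurableSet.iInter fun _ => hG N
  -- The second alternative lets `Nat.find` be defined on the exceptional null set as well.
  have hex : ∀ ω, ∃ M, (∀ N, M ≤ N → ω ∈ G N) ∨ ¬∃ M, ∀ N, M ≤ N → ω ∈ G N := by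
    intro ω
    by_cases h : ∃ M, ∀ N, M ≤ N → ω ∈ G N
    · exact ⟨h.choose, Or.inl h.choose_spec⟩
    · exact ⟨0, Or.inr h⟩
  refine ⟨fun ω => Nat.find (hex ω), measurable_find hex fun M => ?_, ?_⟩
  · have hex' : MeasurableSet {ω | ∃ M, ∀ N, M ≤ N → ω ∈ G N} := by
      simp only [Set.ofPred_exists]
      exact MeasurableSet.iUnion hmeas
    exact (hmeas M).union hex'.compl
  · filter_upwards [hev] with ω hω
    exact (Nat.find_spec (hex ω)).resolve_right (not_not.2 (eventually_atTop.1 hω))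

variable [IsProbabilityMeasure μ]

/-- Slutsky's theorem for a relative error. The quotient `b = (W - V) / (1 + ‖V‖)` tends to `0`
almost surely, and `W = V + (1 + ‖V‖) b` is a continuous function of `(V, b)`. -/
theorem tendstoInDistribution_of_norm_sub_le {E Ω' : Type*} [NormedAddCommGroup E]
    [NormedSpace ℝ E] [MeasurableSpace E] [BorelSpace E] [SecondCountableTopology E]
    [MeasurableSpace Ω'] {μ' : Measure Ω'} [IsProbabilityMeasure μ'] {V W : ℕ → Ω → E}
    {Z : Ω' → E} (hV : TendstoInDistribution V atTop Z (fun _ => μ) μ')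
    (hVm : ∀ N, Measurable (V N)) (hW : ∀ N, Measurable (W N))
    (h : ∀ κ > 0, ∀ᵐ ω ∂μ, ∀ᶠ N in atTop, ‖W N ω - V N ω‖ ≤ κ * ‖V N ω‖) :
    TendstoInDistribution W atTop Z (fun _ => μ) μ' := by
  let b : ℕ → Ω → E := fun N ω => (1 + ‖V N ω‖)⁻¹ • (W N ω - V N ω)
  have hbm : ∀ N, Measurable (b N) := fun N =>
    ((measurable_const.add (hVm N).norm).inv).smul ((hW N).sub (hVm N))
  have hb : TendstoInMeasure μ b atTop fun _ => (0 : E) := by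
    refine tendstoInMeasure_of_tendsto_ae (fun N => (hbm N).aestronglyMeasurable) ?_
    have hk : ∀ᵐ ω ∂μ, ∀ k : ℕ, ∀ᶠ N in atTop,
        ‖W N ω - V N ω‖ ≤ 1 / ((k : ℝ) + 1) * ‖V N ω‖ :=
      ae_all_iff.2 fun k => h _ Nat.one_div_pos_of_nat
    filter_upwards [hk] with ω hω
    rw [Metric.tendsto_nhds]
    intro ε hε
    obtain ⟨k, hk⟩ := exists_nat_one_div_lt hε
    filter_upwards [hω k] with N hN
    rw [dist_zero_right, norm_smul, norm_inv, Real.norm_eq_abs,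
      abs_of_pos (by positivity : 0 < 1 + ‖V N ω‖), inv_mul_lt_iff₀ (by positivity)]
    have h1 := norm_nonneg (V N ω)
    have h2 := mul_le_mul_of_nonneg_right hk.le h1
    nlinarith
  have hg : Continuous fun x : E × E => x.1 + (1 + ‖x.1‖) • x.2 := by fun_prop
  have key := hV.continuous_comp_prodMk_of_tendstoInMeasure_const hg hb
    fun N => (hbm N).aemeasurable
  refine key.congr (fun N => Eventually.of_forall fun ω => ?_)
    (Eventually.of_forall fun ω => by simp)
  have : 1 + ‖V N ω‖ ≠ 0 := by positivity
  simp only [b]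
  rw [smul_inv_smul₀ this]
  abel

/-- The **central limit theorem** for centered square-integrable random vectors. -/
theorem tendstoInDistribution_inv_sqrt_smul_sum {n : ℕ} {X : ℕ → Ω → EuclideanSpace ℝ (Fin n)}
    {S : Matrix (Fin n) (Fin n) ℝ} (hS : S.PosSemidef) (hX : MemLp (X 0) 2 μ)
    (hmean : ∫ ω, X 0 ω ∂μ = 0)
    (hcov : ∀ u, ∫ ω, ⟪u, X 0 ω⟫ ^ 2 ∂μ = u.ofLp ⬝ᵥ S.mulVec u.ofLp)
    (hindep : iIndepFun X μ) (hident : ∀ i, IdentDistrib (X i) (X 0) μ μ) :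
    TendstoInDistribution (fun (N : ℕ) ω => (√(N : ℝ))⁻¹ • ∑ i ∈ Finset.range N, X i ω) atTop
      (id : EuclideanSpace ℝ (Fin n) → EuclideanSpace ℝ (Fin n)) (fun _ => μ)
      (multivariateGaussian 0 S) where
  forall_aemeasurable N :=
    (Finset.aemeasurable_fun_sum _ fun i _ => (hident i).aemeasurable_fst).fun_const_smul _
  aemeasurable_limit := aemeasurable_id
  tendsto := by
    -- Cramér–Wold: the characteristic function at `w` is that of the projection `⟪w, ·⟫` at
    -- frequency `1`, where the scalar central limit theorem applies.
    refine ProbabilityMeasure.tendsto_iff_tendsto_charFun.2 fun w => ?_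
    have hmeas : ∀ N : ℕ, AEMeasurable
        (fun ω => (√(N : ℝ))⁻¹ • ∑ i ∈ Finset.range N, X i ω) μ := fun N =>
      (Finset.aemeasurable_fun_sum _ fun i _ => (hident i).aemeasurable_fst).fun_const_smul _
    have hint : Integrable (X 0) μ := hX.integrable (by norm_num)
    have hLp : MemLp (fun ω => ⟪w, X 0 ω⟫) 2 μ := hX.const_inner w
    have h0 : ∫ ω, ⟪w, X 0 ω⟫ ∂μ = 0 := by
      rw [integral_inner hint, hmean, inner_zero_right]
    have hvar : Var[fun ω => ⟪w, X 0 ω⟫; μ] = w.ofLp ⬝ᵥ S.mulVec w.ofLp := by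
      rw [variance_of_integral_eq_zero hLp.aemeasurable h0, hcov]
    have hclt := tendstoInDistribution_inv_sqrt_mul_sum_sub (X := fun i ω => ⟪w, X i ω⟫)
      (P' := gaussianReal 0 Var[fun ω => ⟪w, X 0 ω⟫; μ].toNNReal)
      (Y := id) HasLaw.id hLp (hindep.comp (fun _ x => ⟪w, x⟫) fun _ => by fun_prop)
      fun i => (hident i).comp (u := fun x => ⟪w, x⟫) (by fun_prop)
    have h1 := (ProbabilityMeasure.tendsto_iff_tendsto_charFun.1 hclt.tendsto) 1
    simp only [h0, mul_zero, sub_zero, ProbabilityMeasure.coe_mk, Measure.map_id] at h1 ⊢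
    rw [charFun_multivariateGaussian hS]
    rw [charFun_gaussianReal, hvar] at h1
    convert h1 using 1
    · funext N
      rw [charFun_apply, charFun_apply, integral_map (hmeas N) (by fun_prop),
        integral_map _ (by fun_prop)]
      · simp [inner_sum, real_inner_smul_right, real_inner_comm]
      · exact (Finset.aemeasurable_fun_sum _ fun i _ =>
          ((hident i).comp (u := fun x => ⟪w, x⟫) (by fun_prop)).aemeasurable_fst).const_mul _
    · congr 2
      have : 0 ≤ w.ofLp ⬝ᵥ S.mulVec w.ofLp := by simpa using hS.dotProduct_mulVec_nonneg w.ofLp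
      simp [this]

end Limits

/-! ### The law of an observation and the Fisher information -/

section Law

variable {n : ℕ} {p g h : ℕ → ℝ → ℝ} {K : ℝ} (C : ℝ) (θ : EuclideanSpace ℝ (Fin n))
  (P : Measure (EuclideanSpace ℝ (Fin n)))

/-- The joint law of an input with law `P` and of its binary response. -/
noncomputable def linkLaw (p : ℕ → ℝ → ℝ) : Measure (EuclideanSpace ℝ (Fin n) × ℕ) :=
  (P.withDensity fun x => ((p 1 (C - ⟪x, θ⟫)).toNNReal : ENNReal)).map (fun x => (x, 1)) +
    (P.withDensity fun x => ((p 0 (C - ⟪x, θ⟫)).toNNReal : ENNReal)).map fun x => (x, 0)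

/-- The gradient of the log-likelihood of one observation. -/
noncomputable def scoreTerm (g : ℕ → ℝ → ℝ) (z : EuclideanSpace ℝ (Fin n) × ℕ) :
    EuclideanSpace ℝ (Fin n) :=
  (-g z.2 (C - ⟪z.1, θ⟫)) • z.1

/-- The conditional mean of the squared derivative of the log-probability. -/
noncomputable def infoWeight (p g : ℕ → ℝ → ℝ) (t : ℝ) : ℝ :=
  p 1 t * g 1 t ^ 2 + p 0 t * g 0 t ^ 2

variable {C θ P}

theorem IsRegularLink.continuous_score (hl : IsRegularLink p g h K) (s : ℕ) : Continuous (g s) :=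
  continuous_iff_continuousAt.2 fun t => (hl.hasDerivAt_score s t).continuousAt

theorem IsRegularLink.continuous_prob (hl : IsRegularLink p g h K) (s : ℕ) :
    Continuous (p s) := by
  have h1 : p s = fun t => Real.exp (Real.log (p s t)) :=
    funext fun t => (Real.exp_log (hl.pos s t)).symm
  rw [h1]
  exact Real.continuous_exp.comp
    (continuous_iff_continuousAt.2 fun t => (hl.hasDerivAt_log s t).continuousAt)

theorem IsRegularLink.infoWeight_eq (hl : IsRegularLink p g h K) (t : ℝ) :
    infoWeight p g t = p 1 t * (-h 1 t) + p 0 t * (-h 0 t) := by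
  unfold infoWeight
  linear_combination hl.info t

theorem IsRegularLink.infoWeight_pos (hl : IsRegularLink p g h K) (t : ℝ) :
    0 < infoWeight p g t := by
  rw [hl.infoWeight_eq]
  have h1 := mul_pos (hl.pos 1 t) (neg_pos.2 (hl.neg 1 t))
  have h0 := mul_pos (hl.pos 0 t) (neg_pos.2 (hl.neg 0 t))
  linarith

theorem IsRegularLink.infoWeight_le (hl : IsRegularLink p g h K) (t : ℝ) :
    infoWeight p g t ≤ K := by
  rw [hl.infoWeight_eq]
  have h1 := mul_le_mul_of_nonneg_left (neg_le.1 (hl.lower 1 t)) (hl.pos 1 t).le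
  have h0 := mul_le_mul_of_nonneg_left (neg_le.1 (hl.lower 0 t)) (hl.pos 0 t).le
  have : p 1 t * K + p 0 t * K = K := by rw [← add_mul, hl.sum_one, one_mul]
  linarith

theorem IsRegularLink.continuous_infoWeight (hl : IsRegularLink p g h K) :
    Continuous (infoWeight p g) := by
  unfold infoWeight
  have := hl.continuous_prob
  have := hl.continuous_score
  fun_prop

theorem integrable_of_linkLaw {H : Type*} [NormedAddCommGroup H] [NormedSpace ℝ H]
    (hl : IsRegularLink p g h K) {f : EuclideanSpace ℝ (Fin n) × ℕ → H} (hf : StronglyMeasurable f)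
    (h1 : Integrable (fun x => p 1 (C - ⟪x, θ⟫) • f (x, 1)) P)
    (h0 : Integrable (fun x => p 0 (C - ⟪x, θ⟫) • f (x, 0)) P) :
    Integrable f (linkLaw C θ P p) ∧ ∫ z, f z ∂(linkLaw C θ P p) =
      ∫ x, (p 1 (C - ⟪x, θ⟫) • f (x, 1) + p 0 (C - ⟪x, θ⟫) • f (x, 0)) ∂P := by
  have hm : ∀ s, Measurable fun x => (p s (C - ⟪x, θ⟫)).toNNReal := by
    intro s
    have := (hl.continuous_prob s).measurable
    fun_prop
  have hcoe : ∀ s x, (((p s (C - ⟪x, θ⟫)).toNNReal : ℝ≥0) : ℝ) = p s (C - ⟪x, θ⟫) :=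
    fun s x => Real.coe_toNNReal _ (hl.pos _ _).le
  have key : ∀ s, Integrable (fun x => p s (C - ⟪x, θ⟫) • f (x, s)) P →
      Integrable f ((P.withDensity fun x => ((p s (C - ⟪x, θ⟫)).toNNReal : ENNReal)).map
        fun x => (x, s)) ∧
      ∫ z, f z ∂((P.withDensity fun x => ((p s (C - ⟪x, θ⟫)).toNNReal : ENNReal)).map
        fun x => (x, s)) = ∫ x, p s (C - ⟪x, θ⟫) • f (x, s) ∂P := by
    intro s hs
    have hpair : Measurable fun x : EuclideanSpace ℝ (Fin n) => (x, s) := by fun_prop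
    constructor
    · rw [integrable_map_measure hf.aestronglyMeasurable hpair.aemeasurable,
        integrable_withDensity_iff_integrable_coe_smul (hm s)]
      simpa only [hcoe, Function.comp] using hs
    · rw [integral_map hpair.aemeasurable hf.aestronglyMeasurable,
        integral_withDensity_eq_integral_smul (hm s)]
      simp only [NNReal.smul_def, hcoe]
  refine ⟨(key 1 h1).1.add_measure (key 0 h0).1, ?_⟩
  rw [linkLaw, integral_add_measure (key 1 h1).1 (key 0 h0).1, (key 1 h1).2, (key 0 h0).2,
    integral_add h1 h0]

/-- By independence the input and the noise have a product law; for a fixed input `x` the response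
is `1` exactly when the noise is at most `C - ⟪x, θ⟫`. The measures are compared section by section.
-/
theorem map_obs_eq_linkLaw {Ω : Type*} [MeasurableSpace Ω] {μ : Measure Ω}
    [IsProbabilityMeasure μ] {φ : Ω → EuclideanSpace ℝ (Fin n)} {d : Ω → ℝ} {ν : Measure ℝ}
    [IsProbabilityMeasure ν] (hφ : Measurable φ) (hd : Measurable d) (hind : IndepFun φ d μ)
    (hdlaw : μ.map d = ν) :
    μ.map (fun ω => (φ ω, obs C θ (φ ω) (d ω))) =
      linkLaw C θ (μ.map φ) (responseProb (cdf ν)) := by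
  have : IsProbabilityMeasure (μ.map φ) := Measure.isProbabilityMeasure_map hφ.aemeasurable
  have hobs : Measurable fun z : EuclideanSpace ℝ (Fin n) × ℝ => (z.1, obs C θ z.1 z.2) := by
    refine measurable_fst.prodMk (Measurable.ite ?_ measurable_const measurable_const)
    exact measurableSet_le (by fun_prop) measurable_const
  have hpair := (indepFun_iff_map_prod_eq_prod_map_map hφ.aemeasurable hd.aemeasurable).1 hind
  have hcomp : μ.map (fun ω => (φ ω, obs C θ (φ ω) (d ω))) =
      ((μ.map φ).prod ν).map fun z => (z.1, obs C θ z.1 z.2) := by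
    rw [← hdlaw, ← hpair, Measure.map_map hobs (hφ.prodMk hd)]
    rfl
  have hm : ∀ s, Measurable fun x : EuclideanSpace ℝ (Fin n) =>
      ((responseProb (cdf ν) s (C - ⟪x, θ⟫)).toNNReal : ENNReal) := by
    intro s
    have hcdf : Measurable (cdf ν) := (monotone_cdf ν).measurable
    have : Measurable (responseProb (cdf ν) s) := by
      unfold responseProb
      split_ifs <;> fun_prop
    fun_prop
  have hs : ∀ s : ℕ, Measurable fun x : EuclideanSpace ℝ (Fin n) => (x, s) := fun s => by fun_prop
  rw [hcomp]
  ext S hS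
  rw [Measure.map_apply hobs hS, Measure.prod_apply (hobs hS), linkLaw, Measure.add_apply,
    Measure.map_apply (hs 1) hS, Measure.map_apply (hs 0) hS, withDensity_apply _ (hs 1 hS),
    withDensity_apply _ (hs 0 hS), ← lintegral_indicator (hs 1 hS), ← lintegral_indicator (hs 0 hS),
    ← lintegral_add_left ((hm 1).indicator (hs 1 hS))]
  refine lintegral_congr fun x => ?_
  set t := C - ⟪x, θ⟫ with ht
  have hle : ∀ y : ℝ, ⟪x, θ⟫ - C + y ≤ 0 ↔ y ≤ t := fun y => by
    rw [ht]
    constructor <;> intro <;> linarith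
  have hIic : ν (Set.Iic t) = ((responseProb (cdf ν) 1 t).toNNReal : ENNReal) := by
    rw [← ofReal_cdf ν t]
    simp [responseProb, ENNReal.ofReal]
  have hIoi : ν (Set.Ioi t) = ((responseProb (cdf ν) 0 t).toNNReal : ENNReal) := by
    rw [← Set.compl_Iic, prob_compl_eq_one_sub measurableSet_Iic, ← ofReal_cdf ν t,
      ← ENNReal.ofReal_one, ← ENNReal.ofReal_sub _ (cdf_nonneg ν t)]
    simp [responseProb, ENNReal.ofReal]
  have hset : Prod.mk x ⁻¹' ((fun z : EuclideanSpace ℝ (Fin n) × ℝ => (z.1, obs C θ z.1 z.2)) ⁻¹' S)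
      = {y | (y ≤ t ∧ (x, 1) ∈ S) ∨ (t < y ∧ (x, 0) ∈ S)} := by
    ext y
    by_cases hy : y ≤ t
    · simp [obs, hle, hy]
    · simp [obs, hle, hy, not_le.1 hy]
  rw [hset]
  by_cases hS1 : (x, 1) ∈ S <;> by_cases hS0 : (x, 0) ∈ S
  · have hU : {y | (y ≤ t ∧ (x, 1) ∈ S) ∨ (t < y ∧ (x, 0) ∈ S)} = Set.Iic t ∪ Set.Ioi t := by
      ext y
      simp [hS1, hS0, le_or_gt]
    rw [hU, measure_union (Set.Iic_disjoint_Ioi le_rfl) measurableSet_Ioi,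
      hIic, hIoi]
    simp [Set.indicator, hS1, hS0, ht]
  · have hU : {y | (y ≤ t ∧ (x, 1) ∈ S) ∨ (t < y ∧ (x, 0) ∈ S)} = Set.Iic t := by
      ext y
      simp [hS1, hS0]
    rw [hU, hIic]
    simp [Set.indicator, hS1, hS0, ht]
  · have hU : {y | (y ≤ t ∧ (x, 1) ∈ S) ∨ (t < y ∧ (x, 0) ∈ S)} = Set.Ioi t := by
      ext y
      simp [hS1, hS0]
    rw [hU, hIoi]
    simp [Set.indicator, hS1, hS0, ht]
  · have hU : {y | (y ≤ t ∧ (x, 1) ∈ S) ∨ (t < y ∧ (x, 0) ∈ S)} = ∅ := by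
      ext y
      simp [hS1, hS0]
    rw [hU]
    simp [Set.indicator, hS1, hS0]

theorem measurable_scoreTerm (hl : IsRegularLink p g h K) :
    Measurable (scoreTerm C θ g) := by
  refine measurable_from_prod_countable_left fun s => Continuous.measurable ?_
  have := hl.continuous_score s
  change Continuous fun x => (-g s (C - ⟪x, θ⟫)) • x
  fun_prop

theorem measurable_linkInfo (hl : IsRegularLink p g h K) : Measurable (linkInfo h C θ) := by
  refine measurable_from_prod_countable_left fun s => Continuous.measurable ?_
  have h1 := hl.cont s
  have h2 : Continuous fun x : EuclideanSpace ℝ (Fin n) => (innerSL ℝ x).smulRight x := by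
    have := ((ContinuousLinearMap.smulRightL ℝ (EuclideanSpace ℝ (Fin n))
      (EuclideanSpace ℝ (Fin n))).continuous.comp (innerSL ℝ).continuous).clm_apply continuous_id
    exact this
  change Continuous fun x => (-h s (C - ⟪x, θ⟫)) • (innerSL ℝ x).smulRight x
  fun_prop

theorem integrable_infoWeight_mul_inner (hl : IsRegularLink p g h K)
    (hP : Integrable (fun x => ‖x‖ ^ 2) P) (u v : EuclideanSpace ℝ (Fin n)) :
    Integrable (fun x => infoWeight p g (C - ⟪x, θ⟫) * (⟪x, u⟫ * ⟪x, v⟫)) P := by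
  refine (hP.const_mul (K * (‖u‖ * ‖v‖))).mono' ?_ (Eventually.of_forall fun x => ?_)
  · have := hl.continuous_infoWeight
    exact Continuous.aestronglyMeasurable (by fun_prop)
  · rw [Real.norm_eq_abs, abs_mul, abs_mul, abs_of_pos (hl.infoWeight_pos _)]
    have h1 := hl.infoWeight_le (C - ⟪x, θ⟫)
    have h0 := (hl.infoWeight_pos (C - ⟪x, θ⟫)).le
    calc _ ≤ K * ((‖x‖ * ‖u‖) * (‖x‖ * ‖v‖)) := by
          gcongr
          · exact h0.trans h1
          · exact abs_real_inner_le_norm _ _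
          · exact abs_real_inner_le_norm _ _
      _ = K * (‖u‖ * ‖v‖) * ‖x‖ ^ 2 := by ring

/-- The score `g` need not be bounded, but its square weighted by the probability is, being one of
the two nonnegative summands of `infoWeight`. This makes the score square integrable. -/
theorem prob_mul_score_sq_le (hl : IsRegularLink p g h K) {s : ℕ} (hs : s = 0 ∨ s = 1) (t : ℝ) :
    p s t * g s t ^ 2 ≤ K := by
  have h1 := mul_nonneg (hl.pos 1 t).le (sq_nonneg (g 1 t))
  have h0 := mul_nonneg (hl.pos 0 t).le (sq_nonneg (g 0 t))
  have h2 := hl.infoWeight_le t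
  unfold infoWeight at h2
  rcases hs with rfl | rfl <;> linarith

theorem prob_le_one (hl : IsRegularLink p g h K) {s : ℕ} (hs : s = 0 ∨ s = 1) (t : ℝ) :
    p s t ≤ 1 := by
  have h1 := hl.pos 1 t
  have h0 := hl.pos 0 t
  have h2 := hl.sum_one t
  rcases hs with rfl | rfl <;> linarith

variable [IsProbabilityMeasure P]

theorem integral_linkLaw_of_bound {H : Type*} [NormedAddCommGroup H] [NormedSpace ℝ H]
    (hl : IsRegularLink p g h K) (hP : Integrable (fun x => ‖x‖ ^ 2) P)
    {f : EuclideanSpace ℝ (Fin n) × ℕ → H} (hf : StronglyMeasurable f) (b : ℝ)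
    (hb : ∀ s, s = 0 ∨ s = 1 → ∀ x, p s (C - ⟪x, θ⟫) * ‖f (x, s)‖ ≤ b * (1 + ‖x‖ ^ 2)) :
    Integrable f (linkLaw C θ P p) ∧ ∫ z, f z ∂(linkLaw C θ P p) =
      ∫ x, (p 1 (C - ⟪x, θ⟫) • f (x, 1) + p 0 (C - ⟪x, θ⟫) • f (x, 0)) ∂P := by
  have key : ∀ s, s = 0 ∨ s = 1 →
      Integrable (fun x => p s (C - ⟪x, θ⟫) • f (x, s)) P := by
    intro s hs
    refine (((integrable_const 1).add hP).const_mul b).mono' ?_ (Eventually.of_forall fun x => ?_)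
    · have h1 := hl.continuous_prob s
      have h2 : StronglyMeasurable fun x : EuclideanSpace ℝ (Fin n) => p s (C - ⟪x, θ⟫) :=
        Continuous.stronglyMeasurable (by fun_prop)
      exact (h2.smul (hf.comp_measurable (by fun_prop))).aestronglyMeasurable
    · rw [norm_smul, Real.norm_eq_abs, abs_of_pos (hl.pos _ _)]
      exact hb s hs x
  exact integrable_of_linkLaw hl hf (key 1 (Or.inr rfl)) (key 0 (Or.inl rfl))

theorem IsRegularLink.bound_nonneg (hl : IsRegularLink p g h K) : 0 ≤ K :=
  (hl.infoWeight_pos 0).le.trans (hl.infoWeight_le 0)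

theorem memLp_scoreTerm (hl : IsRegularLink p g h K) (hP : Integrable (fun x => ‖x‖ ^ 2) P) :
    MemLp (scoreTerm C θ g) 2 (linkLaw C θ P p) := by
  rw [memLp_two_iff_integrable_sq_norm (measurable_scoreTerm hl).aestronglyMeasurable]
  refine (integral_linkLaw_of_bound hl hP
    ((measurable_scoreTerm hl).norm.pow_const 2).stronglyMeasurable K fun s hs x => ?_).1
  have hK := hl.bound_nonneg
  simp only [scoreTerm, norm_smul, norm_neg, Real.norm_eq_abs, mul_pow, sq_abs, abs_mul, abs_pow,
    abs_norm]
  rw [← mul_assoc]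
  exact (mul_le_mul_of_nonneg_right (prob_mul_score_sq_le hl hs _) (sq_nonneg _)).trans
    (mul_le_mul_of_nonneg_left (by linarith) hK)

theorem integral_scoreTerm (hl : IsRegularLink p g h K) (hP : Integrable (fun x => ‖x‖ ^ 2) P) :
    Integrable (scoreTerm C θ g) (linkLaw C θ P p) ∧
      ∫ z, scoreTerm C θ g z ∂(linkLaw C θ P p) = 0 := by
  have hK := hl.bound_nonneg
  obtain ⟨h1, h2⟩ := integral_linkLaw_of_bound (C := C) (θ := θ) hl hP
    (measurable_scoreTerm hl).stronglyMeasurable (1 + K) fun s hs x => by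
      simp only [scoreTerm, norm_smul, norm_neg, Real.norm_eq_abs]
      set t := C - ⟪x, θ⟫
      have h1 : |g s t| ≤ 1 + g s t ^ 2 := by
        rw [← sq_abs]
        nlinarith [abs_nonneg (g s t), sq_nonneg (|g s t| - 1)]
      have h2 : p s t * |g s t| ≤ 1 + K := by
        have h3 := mul_le_mul_of_nonneg_left h1 (hl.pos s t).le
        have h4 := prob_mul_score_sq_le hl hs t
        have h5 := prob_le_one hl hs t
        linarith
      have h3 : ‖x‖ ≤ 1 + ‖x‖ ^ 2 := by nlinarith [sq_nonneg (‖x‖ - 1)]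
      rw [← mul_assoc]
      exact mul_le_mul h2 h3 (norm_nonneg _) (by linarith)
  refine ⟨h1, h2.trans (integral_eq_zero_of_ae (Eventually.of_forall fun x => ?_))⟩
  simp only [scoreTerm, smul_smul, ← add_smul, Pi.zero_apply]
  rw [show ∀ t, p 1 t * -g 1 t + p 0 t * -g 0 t = 0 from fun t => by
    linear_combination -hl.sum_score t, zero_smul]

theorem integral_inner_scoreTerm_sq (hl : IsRegularLink p g h K)
    (hP : Integrable (fun x => ‖x‖ ^ 2) P) (u : EuclideanSpace ℝ (Fin n)) :
    ∫ z, ⟪u, scoreTerm C θ g z⟫ ^ 2 ∂(linkLaw C θ P p) =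
      ∫ x, infoWeight p g (C - ⟪x, θ⟫) * (⟪x, u⟫ * ⟪x, u⟫) ∂P := by
  have hK := hl.bound_nonneg
  have hm : Measurable fun z => ⟪u, scoreTerm C θ g z⟫ ^ 2 :=
    ((measurable_scoreTerm hl).const_inner).pow_const 2
  rw [(integral_linkLaw_of_bound hl hP hm.stronglyMeasurable (K * ‖u‖ ^ 2) fun s hs x => ?_).2]
  · refine integral_congr_ae (Eventually.of_forall fun x => ?_)
    simp only [scoreTerm, real_inner_smul_right, smul_eq_mul, infoWeight, real_inner_comm u x]
    ring
  · simp only [scoreTerm, real_inner_smul_right, mul_pow, neg_sq, norm_mul, norm_pow,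
      Real.norm_eq_abs, sq_abs]
    have h1 := prob_mul_score_sq_le hl hs (C - ⟪x, θ⟫)
    have h2 : ⟪u, x⟫ ^ 2 ≤ ‖u‖ ^ 2 * ‖x‖ ^ 2 := by
      rw [← mul_pow, ← sq_abs]
      exact pow_le_pow_left₀ (abs_nonneg _) (abs_real_inner_le_norm u x) 2
    calc _ = p s (C - ⟪x, θ⟫) * g s (C - ⟪x, θ⟫) ^ 2 * ⟪u, x⟫ ^ 2 := by ring
      _ ≤ K * (‖u‖ ^ 2 * ‖x‖ ^ 2) := mul_le_mul h1 h2 (sq_nonneg _) hK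
      _ ≤ K * ‖u‖ ^ 2 * (1 + ‖x‖ ^ 2) := by nlinarith [mul_nonneg hK (sq_nonneg ‖u‖)]

/-- Information equality: averaging over the response turns `-h` into `infoWeight`, the same weight
as in the second moment of the score. -/
theorem integrable_linkInfo (hl : IsRegularLink p g h K)
    (hP : Integrable (fun x => ‖x‖ ^ 2) P) :
    Integrable (linkInfo h C θ) (linkLaw C θ P p) ∧ ∀ u v,
      ⟪(∫ z, linkInfo h C θ z ∂(linkLaw C θ P p)) u, v⟫ =
      ∫ x, infoWeight p g (C - ⟪x, θ⟫) * (⟪x, u⟫ * ⟪x, v⟫) ∂P := by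
  have hK := hl.bound_nonneg
  obtain ⟨h1, -⟩ := integral_linkLaw_of_bound (C := C) (θ := θ) hl hP
    (measurable_linkInfo hl).stronglyMeasurable K fun s hs x => by
      simp only [linkInfo, norm_smul, norm_neg, Real.norm_eq_abs,
        ContinuousLinearMap.norm_smulRight_apply, innerSL_apply_norm]
      set t := C - ⟪x, θ⟫
      rw [abs_of_neg (hl.neg s t)]
      have h2 := mul_le_mul (prob_le_one hl hs t) (neg_le.1 (hl.lower s t))
        (neg_nonneg.2 (hl.neg s t).le) zero_le_one
      rw [one_mul] at h2
      calc _ = p s t * -h s t * ‖x‖ ^ 2 := by ring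
        _ ≤ K * ‖x‖ ^ 2 := mul_le_mul_of_nonneg_right h2 (sq_nonneg _)
        _ ≤ K * (1 + ‖x‖ ^ 2) := mul_le_mul_of_nonneg_left (by linarith) hK
  refine ⟨h1, fun u v => ?_⟩
  rw [ContinuousLinearMap.integral_apply h1, real_inner_comm,
    ← integral_inner (h1.apply_continuousLinearMap u)]
  have hm : Measurable fun z => ⟪v, linkInfo h C θ z u⟫ :=
    ((measurable_linkInfo hl).apply_continuousLinearMap u).const_inner
  rw [(integral_linkLaw_of_bound hl hP hm.stronglyMeasurable (K * (‖u‖ * ‖v‖))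
    fun s hs x => ?_).2]
  · refine integral_congr_ae (Eventually.of_forall fun x => ?_)
    simp only [linkInfo, smul_apply, ContinuousLinearMap.smulRight_apply, innerSL_apply_apply,
      real_inner_smul_right, smul_eq_mul, hl.infoWeight_eq, real_inner_comm v x]
    ring
  · simp only [linkInfo, smul_apply, ContinuousLinearMap.smulRight_apply, innerSL_apply_apply,
      real_inner_smul_right, Real.norm_eq_abs, abs_mul, abs_neg]
    set t := C - ⟪x, θ⟫
    rw [abs_of_neg (hl.neg s t)]
    have h2 := mul_le_mul (prob_le_one hl hs t) (neg_le.1 (hl.lower s t))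
      (neg_nonneg.2 (hl.neg s t).le) zero_le_one
    rw [one_mul] at h2
    calc _ = p s t * -h s t * (|⟪x, u⟫| * |⟪v, x⟫|) := by ring
      _ ≤ K * ((‖x‖ * ‖u‖) * (‖v‖ * ‖x‖)) := by
        gcongr
        · exact abs_real_inner_le_norm _ _
        · exact abs_real_inner_le_norm _ _
      _ = K * (‖u‖ * ‖v‖) * ‖x‖ ^ 2 := by ring
      _ ≤ K * (‖u‖ * ‖v‖) * (1 + ‖x‖ ^ 2) := mul_le_mul_of_nonneg_left (by linarith) (by positivity)

/-- The Fisher information matrix in terms of the weights `infoWeight`. -/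
noncomputable def weightedInfo (C : ℝ) (θ : EuclideanSpace ℝ (Fin n))
    (P : Measure (EuclideanSpace ℝ (Fin n))) (p g : ℕ → ℝ → ℝ) : Matrix (Fin n) (Fin n) ℝ :=
  Matrix.of fun a b => ∫ x, infoWeight p g (C - ⟪x, θ⟫) * (x a * x b) ∂P

/-- Identifies the information matrix with the operator that the strong law produces as the limit of
the averaged negative Hessians. -/
theorem toEuclideanCLM_weightedInfo (hl : IsRegularLink p g h K)
    (hP : Integrable (fun x => ‖x‖ ^ 2) P) :
    Matrix.toEuclideanCLM (𝕜 := ℝ) (weightedInfo C θ P p g) =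
      ∫ z, linkInfo h C θ z ∂(linkLaw C θ P p) := by
  ext u a
  have h1 := (integrable_linkInfo (C := C) (θ := θ) hl hP).2 u (EuclideanSpace.single a 1)
  rw [EuclideanSpace.inner_single_right] at h1
  simp only [one_mul, conj_trivial] at h1
  rw [h1, Matrix.ofLp_toEuclideanCLM]
  simp only [Matrix.mulVec, dotProduct, weightedInfo, Matrix.of_apply, ← integral_mul_const]
  rw [← integral_finsetSum]
  · refine integral_congr_ae (Eventually.of_forall fun x => ?_)
    have hx : ⟪x, u⟫ = ∑ b, x b * u b := by simp [PiLp.inner_apply, mul_comm]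
    have hxa : ⟪x, EuclideanSpace.single a 1⟫ = x a := by
      simp [EuclideanSpace.inner_single_right]
    simp only [hx, hxa]
    rw [Finset.sum_mul, Finset.mul_sum]
    exact Finset.sum_congr rfl fun b _ => by ring
  · intro b _
    have h2 := integrable_infoWeight_mul_inner (C := C) (θ := θ) hl hP
      (EuclideanSpace.single a 1) (EuclideanSpace.single b 1)
    simp only [EuclideanSpace.inner_single_right, conj_trivial, one_mul] at h2
    exact h2.mul_const _

theorem posDef_weightedInfo (hl : IsRegularLink p g h K)
    (hP : Integrable (fun x => ‖x‖ ^ 2) P)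
    (hnd : ∀ u : EuclideanSpace ℝ (Fin n), u ≠ 0 → ¬∀ᵐ x ∂P, ⟪x, u⟫ = 0) :
    (weightedInfo C θ P p g).PosDef := by
  refine Matrix.PosDef.of_dotProduct_mulVec_pos ?_ fun u hu => ?_
  · ext a b
    simp [weightedInfo, mul_comm]
  · have h1 := Matrix.inner_toEuclideanCLM (weightedInfo C θ P p g) (WithLp.toLp 2 u)
      (WithLp.toLp 2 u)
    rw [toEuclideanCLM_weightedInfo (h := h) hl hP, real_inner_comm,
      (integrable_linkInfo hl hP).2] at h1
    rw [star_trivial]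
    refine lt_of_lt_of_eq ?_ h1
    have hnn : ∀ x, 0 ≤ infoWeight p g (C - ⟪x, θ⟫) *
        (⟪x, WithLp.toLp 2 u⟫ * ⟪x, WithLp.toLp 2 u⟫) := fun x =>
      mul_nonneg (hl.infoWeight_pos _).le (mul_self_nonneg _)
    refine lt_of_le_of_ne (integral_nonneg hnn) fun h0 => ?_
    rw [eq_comm, integral_eq_zero_iff_of_nonneg hnn
      (integrable_infoWeight_mul_inner hl hP _ _)] at h0
    refine hnd (WithLp.toLp 2 u) (by simpa using hu) ?_
    filter_upwards [h0] with x hx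
    simpa [(hl.infoWeight_pos _).ne'] using hx

end Law

/-! ### Almost sure linearization of the score -/

section Linearization

theorem exists_pos_mul_norm_sq_le_inner {n : ℕ} {M : Matrix (Fin n) (Fin n) ℝ} (hM : M.PosDef) :
    ∃ c > 0, ∀ u, c * ‖u‖ ^ 2 ≤ ⟪Matrix.toEuclideanCLM (𝕜 := ℝ) M u, u⟫ := by
  have hpos : ∀ u : EuclideanSpace ℝ (Fin n), u ≠ 0 →
      0 < ⟪Matrix.toEuclideanCLM (𝕜 := ℝ) M u, u⟫ := by
    intro u hu
    rw [real_inner_comm, Matrix.inner_toEuclideanCLM]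
    simpa using hM.dotProduct_mulVec_pos (x := u.ofLp) (by simpa using hu)
  have hcont : Continuous fun u : EuclideanSpace ℝ (Fin n) =>
      ⟪Matrix.toEuclideanCLM (𝕜 := ℝ) M u, u⟫ := by fun_prop
  by_cases hne : (Metric.sphere (0 : EuclideanSpace ℝ (Fin n)) 1).Nonempty
  · obtain ⟨w, hw, hmin⟩ := (isCompact_sphere _ _).exists_isMinOn hne hcont.continuousOn
    have hw0 : w ≠ 0 := ne_of_mem_of_not_mem hw (by simp)
    refine ⟨_, hpos w hw0, fun u => ?_⟩
    rcases eq_or_ne u 0 with rfl | hu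
    · simp
    · have hn : ‖u‖ ≠ 0 := norm_ne_zero_iff.2 hu
      have h1 := hmin (show ‖u‖⁻¹ • u ∈ Metric.sphere (0 : EuclideanSpace ℝ (Fin n)) 1 by
        simp [norm_smul, hn])
      simp only [Set.mem_ofPred_eq, map_smul, real_inner_smul_left, real_inner_smul_right] at h1
      calc _ ≤ ‖u‖⁻¹ * (‖u‖⁻¹ * ⟪Matrix.toEuclideanCLM (𝕜 := ℝ) M u, u⟫) * ‖u‖ ^ 2 := by
            gcongr
        _ = _ := by field_simp
  · refine ⟨1, one_pos, fun u => ?_⟩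
    have hu : u = 0 := by
      by_contra hu
      exact hne ⟨‖u‖⁻¹ • u, by simp [norm_smul, norm_ne_zero_iff.2 hu]⟩
    simp [hu]

variable {Ω : Type*} [MeasurableSpace Ω] {μ : Measure Ω}

theorem strong_law_ae_comp {𝒴 H : Type*} [MeasurableSpace 𝒴] [NormedAddCommGroup H]
    [NormedSpace ℝ H] [CompleteSpace H] [MeasurableSpace H] [BorelSpace H] {Y : ℕ → Ω → 𝒴}
    {ρ : Measure 𝒴} (hY : ∀ i, Measurable (Y i)) (hindep : iIndepFun Y μ)
    (hlaw : ∀ i, μ.map (Y i) = ρ) {f : 𝒴 → H} (hf : Measurable f) (hint : Integrable f ρ) :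
    ∀ᵐ ω ∂μ, Tendsto (fun N : ℕ => (N : ℝ)⁻¹ • ∑ i ∈ Finset.range N, f (Y i ω)) atTop
      (𝓝 (∫ y, f y ∂ρ)) := by
  have h0 : Integrable (fun ω => f (Y 0 ω)) μ := by
    rw [← hlaw 0] at hint
    exact hint.comp_measurable (hY 0)
  have h1 := strong_law_ae (fun i ω => f (Y i ω)) h0
    (fun i j hij => (hindep.indepFun hij).comp hf hf) fun i =>
      (IdentDistrib.mk (hY i).aemeasurable (hY 0).aemeasurable
        ((hlaw i).trans (hlaw 0).symm)).comp hf
  have h2 : ∫ ω, f (Y 0 ω) ∂μ = ∫ y, f y ∂ρ := by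
    rw [← hlaw 0, integral_map (hY 0).aemeasurable]
    rw [hlaw 0]
    exact hint.aestronglyMeasurable
  rwa [h2] at h1

variable {n : ℕ} {p g h : ℕ → ℝ → ℝ} {K C : ℝ} {θ : EuclideanSpace ℝ (Fin n)}
  {P : Measure (EuclideanSpace ℝ (Fin n))}

theorem exists_forall_abs_sub_le (hl : IsRegularLink p g h K) (C : ℝ)
    (θ : EuclideanSpace ℝ (Fin n)) {M η : ℝ} (hM : 0 ≤ M) (hη : 0 < η) :
    ∃ δ > 0, ∀ s, s = 0 ∨ s = 1 → ∀ x : EuclideanSpace ℝ (Fin n), ‖x‖ ≤ M → ∀ ξ,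
      |ξ - (C - ⟪x, θ⟫)| ≤ δ * ‖x‖ → |h s ξ - h s (C - ⟪x, θ⟫)| ≤ η := by
  -- All thresholds `C - ⟪x, θ⟫` with `‖x‖ ≤ M`, and all points within `M` of them, lie in `[-R,
  -- R]`, where `h` is uniformly continuous.
  set R := |C| + M * ‖θ‖ + M with hR
  have huc : ∀ s, ∃ δ > 0, ∀ a ∈ Metric.closedBall (0 : ℝ) R, ∀ b ∈ Metric.closedBall (0 : ℝ) R,
      dist a b < δ → dist (h s a) (h s b) < η := fun s =>
    Metric.uniformContinuousOn_iff.1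
      ((isCompact_closedBall (0 : ℝ) R).uniformContinuousOn_of_continuous
        (hl.cont s).continuousOn) η hη
  obtain ⟨δ₀, hδ₀, h0⟩ := huc 0
  obtain ⟨δ₁, hδ₁, h1⟩ := huc 1
  set δ := min 1 (min δ₀ δ₁ / (M + 1)) with hδ
  have hmin : 0 < min δ₀ δ₁ := lt_min hδ₀ hδ₁
  have hδ0 : 0 < δ := lt_min one_pos (by positivity)
  refine ⟨δ, hδ0, fun s hs x hx ξ hξ => ?_⟩
  have ht : |C - ⟪x, θ⟫| ≤ |C| + M * ‖θ‖ := by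
    refine (abs_sub _ _).trans ?_
    gcongr
    exact (abs_real_inner_le_norm _ _).trans (by gcongr)
  have hξ1 : |ξ - (C - ⟪x, θ⟫)| ≤ M :=
    hξ.trans ((mul_le_mul (min_le_left _ _) hx (norm_nonneg _) zero_le_one).trans (one_mul M).le)
  have hξ2 : |ξ - (C - ⟪x, θ⟫)| < min δ₀ δ₁ := by
    refine (hξ.trans (mul_le_mul (min_le_right _ _) hx (norm_nonneg _) (by positivity))).trans_lt ?_
    rw [div_mul_eq_mul_div, div_lt_iff₀ (by positivity)]
    nlinarith
  have hb1 : C - ⟪x, θ⟫ ∈ Metric.closedBall (0 : ℝ) R := by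
    rw [mem_closedBall_zero_iff, Real.norm_eq_abs]
    linarith
  have hb2 : ξ ∈ Metric.closedBall (0 : ℝ) R := by
    rw [mem_closedBall_zero_iff, Real.norm_eq_abs]
    have := abs_add_le (ξ - (C - ⟪x, θ⟫)) (C - ⟪x, θ⟫)
    rw [sub_add_cancel] at this
    linarith
  rcases hs with rfl | rfl
  · exact (h0 ξ hb2 _ hb1 (hξ2.trans_le (min_le_left _ _))).le
  · exact (h1 ξ hb2 _ hb1 (hξ2.trans_le (min_le_right _ _))).le

/-- The integrand is the envelope of the Hessian's oscillation: small for bounded inputs, at most `K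
‖x‖²` for large ones. By dominated convergence the second part is negligible. -/
theorem exists_integral_ite_lt (hK : 0 ≤ K) (hP : Integrable (fun x => ‖x‖ ^ 2) P) {κ : ℝ}
    (hκ : 0 < κ) : ∃ η > 0, ∃ k : ℕ,
      Integrable (fun x => (if ‖x‖ ≤ (k : ℝ) then η else K) * ‖x‖ ^ 2) P ∧
      ∫ x, (if ‖x‖ ≤ (k : ℝ) then η else K) * ‖x‖ ^ 2 ∂P < κ := by
  have hnn : 0 ≤ ∫ x, ‖x‖ ^ 2 ∂P := integral_nonneg fun x => sq_nonneg _
  set η := κ / (2 * (1 + ∫ x, ‖x‖ ^ 2 ∂P)) with hη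
  have hη0 : 0 < η := by positivity
  have hlt : η * ∫ x, ‖x‖ ^ 2 ∂P < κ := by
    rw [hη, div_mul_eq_mul_div, div_lt_iff₀ (by positivity)]
    nlinarith
  have hmeas : ∀ k : ℕ, AEStronglyMeasurable
      (fun x : EuclideanSpace ℝ (Fin n) => (if ‖x‖ ≤ (k : ℝ) then η else K) * ‖x‖ ^ 2) P :=
    fun k => ((Measurable.ite (measurableSet_le measurable_norm measurable_const)
      measurable_const measurable_const).mul (measurable_norm.pow_const 2)).aestronglyMeasurable
  have hbound : ∀ (k : ℕ) (x : EuclideanSpace ℝ (Fin n)),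
      ‖(if ‖x‖ ≤ (k : ℝ) then η else K) * ‖x‖ ^ 2‖ ≤ (η + K) * ‖x‖ ^ 2 := by
    intro k x
    rw [Real.norm_eq_abs, abs_of_nonneg (mul_nonneg (by split_ifs <;> positivity) (sq_nonneg _))]
    refine mul_le_mul_of_nonneg_right ?_ (sq_nonneg _)
    split_ifs <;> linarith
  have hlim : Tendsto (fun k : ℕ => ∫ x, (if ‖x‖ ≤ (k : ℝ) then η else K) * ‖x‖ ^ 2 ∂P) atTop
      (𝓝 (∫ x, η * ‖x‖ ^ 2 ∂P)) := by
    refine tendsto_integral_of_dominated_convergence (fun x => (η + K) * ‖x‖ ^ 2) hmeas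
      (hP.const_mul _) (fun k => Eventually.of_forall (hbound k)) (Eventually.of_forall fun x => ?_)
    refine tendsto_const_nhds.congr' ?_
    filter_upwards [tendsto_natCast_atTop_atTop.eventually_ge_atTop ‖x‖] with k hk
    rw [if_pos hk]
  rw [integral_const_mul] at hlim
  obtain ⟨k, hk⟩ := (hlim.eventually_lt_const hlt).exists
  exact ⟨η, hη0, k, (hP.const_mul (η + K)).mono' (hmeas k) (Eventually.of_forall (hbound k)), hk⟩

variable [IsProbabilityMeasure P] {φ : ℕ → Ω → EuclideanSpace ℝ (Fin n)} {s : ℕ → Ω → ℕ}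

/-- Half of `κ` pays for the averaged envelope, the other half for the distance of the averaged
Hessian from its mean. The radius `δ` is deterministic, and the two laws of large numbers do not
involve `x`, so the bound holds on the whole ball at once. -/
theorem exists_ae_norm_linkScore_sub_le (hl : IsRegularLink p g h K)
    (hP : Integrable (fun x => ‖x‖ ^ 2) P) (hφ : ∀ i, Measurable (φ i))
    (hs : ∀ i, Measurable (s i)) (hs01 : ∀ i ω, s i ω = 0 ∨ s i ω = 1)
    (hindep : iIndepFun (fun i ω => (φ i ω, s i ω)) μ) (hφlaw : ∀ i, μ.map (φ i) = P)
    (hlaw : ∀ i, μ.map (fun ω => (φ i ω, s i ω)) = linkLaw C θ P p) {κ : ℝ} (hκ : 0 < κ) :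
    ∃ δ > 0, ∀ᵐ ω ∂μ, ∀ᶠ N : ℕ in atTop, ∀ x ∈ Metric.closedBall θ δ,
      ‖(N : ℝ)⁻¹ • linkScore C (fun i => φ i ω) (fun i => s i ω) N g x -
        ((N : ℝ)⁻¹ • linkScore C (fun i => φ i ω) (fun i => s i ω) N g θ -
          (∫ z, linkInfo h C θ z ∂(linkLaw C θ P p)) (x - θ))‖ ≤ κ * ‖x - θ‖ := by
  obtain ⟨η, hη, k, hint, hlt⟩ := exists_integral_ite_lt hl.bound_nonneg hP (half_pos hκ)
  obtain ⟨δ, hδ, hosc⟩ := exists_forall_abs_sub_le hl C θ k.cast_nonneg hη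
  refine ⟨δ, hδ, ?_⟩
  have hem : Measurable fun x : EuclideanSpace ℝ (Fin n) =>
      (if ‖x‖ ≤ (k : ℝ) then η else K) * ‖x‖ ^ 2 :=
    (Measurable.ite (measurableSet_le measurable_norm measurable_const)
      measurable_const measurable_const).mul (measurable_norm.pow_const 2)
  have h1 := strong_law_ae_comp hφ (hindep.comp (fun _ => Prod.fst) fun _ => measurable_fst)
    hφlaw hem hint
  have h2 := strong_law_ae_comp (fun i => (hφ i).prodMk (hs i)) hindep hlaw
    (measurable_linkInfo hl) (integrable_linkInfo hl hP).1
  filter_upwards [h1, h2] with ω h1 h2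
  rw [tendsto_iff_norm_sub_tendsto_zero] at h2
  filter_upwards [h1.eventually_lt_const hlt, h2.eventually_lt_const (half_pos hκ)] with N h1 h2 x hx
  have h3 := norm_linkScore_sub_le (φ := fun i => φ i ω) (s := fun i => s i ω) (N := N) (C := C)
    (θ := θ) (δ := δ) hl (e := fun i => (if ‖φ i ω‖ ≤ (k : ℝ) then η else K) * ‖φ i ω‖ ^ 2)
    (fun i ξ hξ => by
      refine mul_le_mul_of_nonneg_right ?_ (sq_nonneg _)
      split_ifs with hle
      · exact hosc _ (hs01 i ω) _ hle ξ hξ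
      -- Both curvatures lie in `[-K, 0]`, so they differ by at most `K`.
      · rw [abs_le]
        have a1 := hl.neg (s i ω) ξ
        have a2 := hl.lower (s i ω) ξ
        have a3 := hl.neg (s i ω) (C - ⟪φ i ω, θ⟫)
        have a4 := hl.lower (s i ω) (C - ⟪φ i ω, θ⟫)
        constructor <;> linarith) hx
  set A := ∑ i ∈ Finset.range N, linkInfo h C θ (φ i ω, s i ω)
  set L := ∫ z, linkInfo h C θ z ∂(linkLaw C θ P p)
  set Sx := linkScore C (fun i => φ i ω) (fun i => s i ω) N g x
  set Sθ := linkScore C (fun i => φ i ω) (fun i => s i ω) N g θ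
  have hN : (0 : ℝ) ≤ (N : ℝ)⁻¹ := by positivity
  have hsplit : (N : ℝ)⁻¹ • Sx - ((N : ℝ)⁻¹ • Sθ - L (x - θ)) =
      (N : ℝ)⁻¹ • (Sx - Sθ + A (x - θ)) - ((N : ℝ)⁻¹ • A - L) (x - θ) := by
    rw [sub_apply, smul_apply, smul_add, smul_sub]
    abel
  rw [hsplit]
  calc _ ≤ ‖(N : ℝ)⁻¹ • (Sx - Sθ + A (x - θ))‖ + ‖((N : ℝ)⁻¹ • A - L) (x - θ)‖ := norm_sub_le _ _
    _ ≤ κ / 2 * ‖x - θ‖ + κ / 2 * ‖x - θ‖ := by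
      refine add_le_add ?_ ?_
      · rw [norm_smul, Real.norm_eq_abs, abs_of_nonneg hN]
        refine (mul_le_mul_of_nonneg_left h3 hN).trans ?_
        rw [← mul_assoc]
        exact mul_le_mul_of_nonneg_right h1.le (norm_nonneg _)
      · exact (ContinuousLinearMap.le_opNorm _ _).trans
          (mul_le_mul_of_nonneg_right h2.le (norm_nonneg _))
    _ = κ * ‖x - θ‖ := by ring

end Linearization

/-! ### The maximum likelihood estimator -/

section Estimator

variable {n : ℕ} {p g h : ℕ → ℝ → ℝ} {K C : ℝ}

theorem measurable_log_link (hl : IsRegularLink p g h K) (C : ℝ) :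
    Measurable fun z : (EuclideanSpace ℝ (Fin n) × EuclideanSpace ℝ (Fin n)) × ℕ =>
      Real.log (p z.2 (C - ⟪z.1.1, z.1.2⟫)) := by
  refine measurable_from_prod_countable_left fun s => Continuous.measurable ?_
  have hc : Continuous fun t => Real.log (p s t) :=
    continuous_iff_continuousAt.2 fun t => (hl.hasDerivAt_log s t).continuousAt
  exact hc.comp (by fun_prop)

theorem exists_measurable_argmax_linkLogLikelihood (hl : IsRegularLink p g h K)
    (hle : ∀ s t, p s t ≤ 1) (C : ℝ) (N : ℕ) :
    ∃ Θ : (Fin N → EuclideanSpace ℝ (Fin n) × ℕ) → EuclideanSpace ℝ (Fin n), Measurable Θ ∧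
      ∀ (φ : ℕ → EuclideanSpace ℝ (Fin n)) (s : ℕ → ℕ),
        StrictConcaveOn ℝ Set.univ (linkLogLikelihood C φ s N p) →
        ∀ x, IsMaxOn (linkLogLikelihood C φ s N p) Set.univ x →
          Θ (fun i => (φ i, s i)) = x := by
  obtain ⟨Θ, hΘ, hmax⟩ := exists_measurable_argmax
    (fun (y : Fin N → EuclideanSpace ℝ (Fin n) × ℕ) γ =>
      ∑ i, Real.log (p (y i).2 (C - ⟪(y i).1, γ⟫)))
    (fun q => Finset.measurable_sum _ fun i _ => (measurable_log_link hl C).comp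
      (g := fun z : (EuclideanSpace ℝ (Fin n) × EuclideanSpace ℝ (Fin n)) × ℕ =>
        Real.log (p z.2 (C - ⟪z.1.1, z.1.2⟫)))
      (f := fun y : Fin N → EuclideanSpace ℝ (Fin n) × ℕ => (((y i).1, q), (y i).2))
      (by fun_prop))
    (fun y => continuous_finsetSum _ fun i _ => continuous_iff_continuousAt.2 fun γ =>
      (hasGradientAt_log_link hl C (y i).2 (y i).1 γ).continuousAt)
    (fun y q => Finset.sum_nonpos fun i _ => Real.log_nonpos (hl.pos _ _).le (hle _ _))
  refine ⟨Θ, hΘ, fun φ s hsc x hx => ?_⟩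
  have heq : linkLogLikelihood C φ s N p =
      fun γ => ∑ i : Fin N, Real.log (p (s i) (C - ⟪φ i, γ⟫)) :=
    funext fun γ => Finset.sum_range fun i => Real.log (p (s i) (C - ⟪φ i, γ⟫))
  rw [heq] at hsc hx
  exact hmax _ hsc x hx

theorem linkScore_eq_zero_of_isMaxOn (hl : IsRegularLink p g h K)
    {φ : ℕ → EuclideanSpace ℝ (Fin n)} {s : ℕ → ℕ} {N : ℕ} {x : EuclideanSpace ℝ (Fin n)}
    (hx : IsMaxOn (linkLogLikelihood C φ s N p) Set.univ x) : linkScore C φ s N g x = 0 := by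
  have h1 := (hx.isLocalMax univ_mem).hasFDerivAt_eq_zero
    (hasGradientAt_linkLogLikelihood hl x).hasFDerivAt
  simpa using h1

variable {Ω : Type*} [MeasurableSpace Ω] {μ : Measure Ω} [IsProbabilityMeasure μ]
  {θ : EuclideanSpace ℝ (Fin n)} {P : Measure (EuclideanSpace ℝ (Fin n))}
  [IsProbabilityMeasure P] {φ : ℕ → Ω → EuclideanSpace ℝ (Fin n)} {s : ℕ → Ω → ℕ}

/-- The score has covariance `M`, so its image under the symmetric `M⁻¹` has covariance `M⁻¹ M M⁻¹ =
M⁻¹`. -/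
theorem tendstoInDistribution_inv_sqrt_smul_sum_scoreTerm (hl : IsRegularLink p g h K)
    (hP : Integrable (fun x => ‖x‖ ^ 2) P) (hφ : ∀ i, Measurable (φ i))
    (hs : ∀ i, Measurable (s i)) (hindep : iIndepFun (fun i ω => (φ i ω, s i ω)) μ)
    (hlaw : ∀ i, μ.map (fun ω => (φ i ω, s i ω)) = linkLaw C θ P p)
    (hM : (weightedInfo C θ P p g).PosDef) :
    TendstoInDistribution (fun (N : ℕ) ω => (√(N : ℝ))⁻¹ • ∑ i ∈ Finset.range N,
      Matrix.toEuclideanCLM (𝕜 := ℝ) (weightedInfo C θ P p g)⁻¹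
        (scoreTerm C θ g (φ i ω, s i ω))) atTop
      (id : EuclideanSpace ℝ (Fin n) → EuclideanSpace ℝ (Fin n)) (fun _ => μ)
      (multivariateGaussian 0 (weightedInfo C θ P p g)⁻¹) := by
  set M := weightedInfo C θ P p g with hMdef
  set Λ' := Matrix.toEuclideanCLM (𝕜 := ℝ) M⁻¹ with hΛ'
  have hY : ∀ i, Measurable fun ω => (φ i ω, s i ω) := fun i => (hφ i).prodMk (hs i)
  have hm := measurable_scoreTerm (C := C) (θ := θ) hl
  have hm' : Measurable fun z => Λ' (scoreTerm C θ g z) := Λ'.measurable.comp hm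
  have hMinv := hM.inv
  have hΛΛ' : ∀ u, Matrix.toEuclideanCLM (𝕜 := ℝ) M (Λ' u) = u := by
    intro u
    rw [hΛ', ← mul_apply_eq_comp, ← map_mul,
      Matrix.mul_nonsing_inv _ ((Matrix.isUnit_iff_isUnit_det _).1 hM.isUnit), map_one]
    rfl
  have hsymm : ∀ u z, ⟪u, Λ' z⟫ = ⟪Λ' u, z⟫ := by
    intro u z
    have hT : M⁻¹.transpose = M⁻¹ := by
      rw [← Matrix.conjTranspose_eq_transpose_of_trivial]
      exact hMinv.isHermitian.eq
    rw [real_inner_comm z (Λ' u), hΛ', Matrix.inner_toEuclideanCLM, Matrix.inner_toEuclideanCLM,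
      Matrix.dotProduct_mulVec, ← Matrix.mulVec_transpose, hT, dotProduct_comm]
  refine tendstoInDistribution_inv_sqrt_smul_sum
    (X := fun i ω => Λ' (scoreTerm C θ g (φ i ω, s i ω))) hMinv.posSemidef ?_ ?_ (fun u => ?_)
    (hindep.comp (fun _ z => Λ' (scoreTerm C θ g z)) fun _ => hm') fun i =>
      (IdentDistrib.mk (hY i).aemeasurable (hY 0).aemeasurable
        ((hlaw i).trans (hlaw 0).symm)).comp hm'
  · have h1 := memLp_scoreTerm (C := C) (θ := θ) hl hP
    rw [← hlaw 0, memLp_map_measure_iff hm.aestronglyMeasurable (hY 0).aemeasurable] at h1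
    exact Λ'.comp_memLp' h1
  · have h1 := integral_scoreTerm (C := C) (θ := θ) hl hP
    have h2 : ∫ z, Λ' (scoreTerm C θ g z) ∂(linkLaw C θ P p) = 0 := by
      rw [Λ'.integral_comp_comm h1.1, h1.2, map_zero]
    rw [← hlaw 0, integral_map (hY 0).aemeasurable hm'.aestronglyMeasurable] at h2
    exact h2
  · have h1 := integral_inner_scoreTerm_sq (C := C) (θ := θ) hl hP (Λ' u)
    rw [← (integrable_linkInfo hl hP).2, ← toEuclideanCLM_weightedInfo hl hP, ← hMdef, hΛΛ',
      hΛ', Matrix.inner_toEuclideanCLM, ← hΛ', ← hlaw 0,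
      integral_map (hY 0).aemeasurable
        ((hm.const_inner).pow_const 2).aestronglyMeasurable] at h1
    rw [← h1]
    simp only [hsymm]

/-- The maximum likelihood estimator of a binary response model with a regular link exists
eventually, is strongly consistent and is asymptotically normal. -/
theorem exists_maximum_likelihood_estimator (hl : IsRegularLink p g h K)
    (hle : ∀ s t, p s t ≤ 1) (hP : Integrable (fun x => ‖x‖ ^ 2) P)
    (hφ : ∀ i, Measurable (φ i)) (hs : ∀ i, Measurable (s i))
    (hs01 : ∀ i ω, s i ω = 0 ∨ s i ω = 1)
    (hindep : iIndepFun (fun i ω => (φ i ω, s i ω)) μ) (hφlaw : ∀ i, μ.map (φ i) = P)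
    (hlaw : ∀ i, μ.map (fun ω => (φ i ω, s i ω)) = linkLaw C θ P p)
    (hexc : ∀ᵐ ω ∂μ, ∃ N, (excitation (fun i => φ i ω) N).PosDef)
    (hM : (weightedInfo C θ P p g).PosDef) :
    ∃ (θhat : ℕ → Ω → EuclideanSpace ℝ (Fin n)) (n₂ : Ω → ℕ),
      (∀ N, Measurable[MeasurableSpace.comap
        (fun ω (i : Fin N) => (φ i ω, s i ω)) inferInstance] (θhat N)) ∧
      Measurable n₂ ∧
      (∀ᵐ ω ∂μ, ∀ N, n₂ ω ≤ N →
        IsMaxOn (linkLogLikelihood C (fun i => φ i ω) (fun i => s i ω) N p)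
          Set.univ (θhat N ω)) ∧
      (∀ᵐ ω ∂μ, Tendsto (fun N => θhat N ω) atTop (𝓝 θ)) ∧
      TendstoInDistribution (fun (N : ℕ) ω => √(N : ℝ) • (θhat N ω - θ)) atTop
        (id : EuclideanSpace ℝ (Fin n) → EuclideanSpace ℝ (Fin n)) (fun _ => μ)
        (multivariateGaussian 0 (weightedInfo C θ P p g)⁻¹) := by
  set M := weightedInfo C θ P p g with hMdef
  have hY : ∀ i, Measurable fun ω => (φ i ω, s i ω) := fun i => (hφ i).prodMk (hs i)
  choose Θ hΘ hΘmax using exists_measurable_argmax_linkLogLikelihood (n := n) hl hle C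
  set θhat : ℕ → Ω → EuclideanSpace ℝ (Fin n) := fun N ω => Θ N fun i => (φ i ω, s i ω)
    with hθhat
  have hθm : ∀ N, Measurable (θhat N) := fun N =>
    (hΘ N).comp (measurable_pi_lambda _ fun i => hY i)
  have hlin : ∀ᵐ ω ∂μ, ∀ κ > 0, ∃ δ > 0, ∀ᶠ N : ℕ in atTop, ∀ x ∈ Metric.closedBall θ δ,
      ‖(N : ℝ)⁻¹ • linkScore C (fun i => φ i ω) (fun i => s i ω) N g x -
        ((N : ℝ)⁻¹ • linkScore C (fun i => φ i ω) (fun i => s i ω) N g θ -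
          Matrix.toEuclideanCLM (𝕜 := ℝ) M (x - θ))‖ ≤ κ * ‖x - θ‖ := by
    -- Only the countably many `κ = 1 / (k + 1)` are used, so that a single null set serves all `κ`.
    choose δ hδ hae using fun k : ℕ => exists_ae_norm_linkScore_sub_le (C := C) (θ := θ) hl hP hφ
      hs hs01 hindep hφlaw hlaw (Nat.one_div_pos_of_nat (α := ℝ) (n := k))
    filter_upwards [ae_all_iff.2 hae] with ω hω κ hκ
    obtain ⟨k, hk⟩ := exists_nat_one_div_lt hκ
    refine ⟨δ k, hδ k, ?_⟩
    filter_upwards [hω k] with N hN x hx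
    rw [hMdef, toEuclideanCLM_weightedInfo hl hP]
    exact (hN x hx).trans (mul_le_mul_of_nonneg_right hk.le (norm_nonneg _))
  have hscore : ∀ᵐ ω ∂μ, Tendsto (fun N : ℕ =>
      (N : ℝ)⁻¹ • linkScore C (fun i => φ i ω) (fun i => s i ω) N g θ) atTop (𝓝 0) := by
    have h1 := integral_scoreTerm (C := C) (θ := θ) hl hP
    have h2 := strong_law_ae_comp hY hindep hlaw (measurable_scoreTerm hl) h1.1
    rw [h1.2] at h2
    exact h2
  have hstrict : ∀ᵐ ω ∂μ, ∀ᶠ N in atTop, StrictConcaveOn ℝ Set.univ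
      (linkLogLikelihood C (fun i => φ i ω) (fun i => s i ω) N p) := by
    filter_upwards [hexc] with ω hω
    obtain ⟨N₀, hN₀⟩ := hω
    filter_upwards [eventually_ge_atTop N₀] with N hN
    refine strictConcaveOn_linkLogLikelihood hl fun u hu => ?_
    obtain ⟨i, hi, hne⟩ := inner_ne_zero_of_excitation_posDef hN₀ hu
    exact ⟨i, hi.trans_le hN, hne⟩
  obtain ⟨c, hc, hcM⟩ := exists_pos_mul_norm_sq_le_inner hM
  have hmle : ∀ᵐ ω ∂μ, ∀ ε > 0, ∀ᶠ N in atTop, θhat N ω ∈ Metric.closedBall θ ε ∧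
      IsMaxOn (linkLogLikelihood C (fun i => φ i ω) (fun i => s i ω) N p) Set.univ
        (θhat N ω) := by
    filter_upwards [hlin, hscore, hstrict] with ω h1 h2 h3 ε hε
    filter_upwards [h3, eventually_exists_isMaxOn_of_linearization hc hcM
      (fun N => concaveOn_linkLogLikelihood hl) (fun N => hasGradientAt_linkLogLikelihood hl)
      h2 h1 hε] with N h3 h4
    obtain ⟨x, hx, hmax⟩ := h4
    have heq : θhat N ω = x := hΘmax N (fun i => φ i ω) (fun i => s i ω) h3 x hmax
    rw [heq]
    exact ⟨hx, hmax⟩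
  have hcons : ∀ᵐ ω ∂μ, Tendsto (fun N => θhat N ω) atTop (𝓝 θ) := by
    filter_upwards [hmle] with ω hω
    refine Metric.tendsto_nhds.2 fun ε hε => ?_
    filter_upwards [hω (ε / 2) (half_pos hε)] with N hN
    exact (Metric.mem_closedBall.1 hN.1).trans_lt (half_lt_self hε)
  have hG : ∀ N, MeasurableSet {ω | IsMaxOn
      (linkLogLikelihood C (fun i => φ i ω) (fun i => s i ω) N p) Set.univ (θhat N ω)} := by
    intro N
    have hmeas : ∀ x : Ω → EuclideanSpace ℝ (Fin n), Measurable x →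
        Measurable fun ω => linkLogLikelihood C (fun i => φ i ω) (fun i => s i ω) N p (x ω) :=
      fun x hx => Finset.measurable_sum _ fun i _ =>
        (measurable_log_link hl C).comp (((hφ i).prodMk hx).prodMk (hs i))
    -- By continuity it suffices to compare with a dense sequence, which makes the event a countable
    -- intersection.
    have hset : {ω | IsMaxOn (linkLogLikelihood C (fun i => φ i ω) (fun i => s i ω) N p)
        Set.univ (θhat N ω)} = ⋂ j, {ω | linkLogLikelihood C (fun i => φ i ω) (fun i => s i ω) N p
          (TopologicalSpace.denseSeq _ j) ≤
          linkLogLikelihood C (fun i => φ i ω) (fun i => s i ω) N p (θhat N ω)} := by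
      ext ω
      simp only [Set.mem_iInter, Set.mem_ofPred_eq]
      refine ⟨fun hω j => hω (Set.mem_univ _), fun hω x _ => ?_⟩
      have hcont : Continuous
          (linkLogLikelihood C (fun i => φ i ω) (fun i => s i ω) N p) :=
        continuous_iff_continuousAt.2 fun γ =>
          (hasGradientAt_linkLogLikelihood hl γ).continuousAt
      exact (TopologicalSpace.denseRange_denseSeq (EuclideanSpace ℝ (Fin n))).induction_on
        (p := fun x => linkLogLikelihood C (fun i => φ i ω) (fun i => s i ω) N p x ≤
          linkLogLikelihood C (fun i => φ i ω) (fun i => s i ω) N p (θhat N ω)) x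
        (isClosed_le hcont continuous_const) hω
    rw [hset]
    exact MeasurableSet.iInter fun j =>
      measurableSet_le (hmeas _ measurable_const) (hmeas _ (hθm N))
  obtain ⟨n₂, hn₂, hn₂max⟩ := exists_measurable_index (μ := μ) hG (by
    filter_upwards [hmle] with ω hω
    exact (hω 1 one_pos).mono fun N hN => hN.2)
  refine ⟨θhat, n₂, fun N => (hΘ N).comp (comap_measurable _), hn₂, hn₂max, hcons, ?_⟩
  set Λ' := Matrix.toEuclideanCLM (𝕜 := ℝ) M⁻¹ with hΛ'
  have hΛ'Λ : ∀ u, Λ' (Matrix.toEuclideanCLM (𝕜 := ℝ) M u) = u := by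
    intro u
    rw [hΛ', ← mul_apply_eq_comp, ← map_mul,
      Matrix.nonsing_inv_mul _ ((Matrix.isUnit_iff_isUnit_det _).1 hM.isUnit), map_one]
    rfl
  refine tendstoInDistribution_of_norm_sub_le
    (tendstoInDistribution_inv_sqrt_smul_sum_scoreTerm hl hP hφ hs hindep hlaw hM)
    (fun N => ?_) (fun N => ((hθm N).sub_const _).fun_const_smul _) fun κ hκ => ?_
  · have hsum : Measurable fun ω => ∑ i ∈ Finset.range N,
        Λ' (scoreTerm C θ g (φ i ω, s i ω)) :=
      Finset.measurable_sum _ fun i _ =>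
        Λ'.measurable.comp ((measurable_scoreTerm hl).comp (hY i))
    exact hsum.const_smul (√(N : ℝ))⁻¹
  · filter_upwards [hlin, hcons, hmle] with ω h1 h2 h3
    have h4 : ∀ᶠ N in atTop,
        linkScore C (fun i => φ i ω) (fun i => s i ω) N g (θhat N ω) = 0 :=
      (h3 1 one_pos).mono fun N hN => linkScore_eq_zero_of_isMaxOn hl hN.2
    filter_upwards [eventually_norm_sub_le_of_linearization hΛ'Λ h1 h2 h4 hκ] with N hN
    have hscale : (√(N : ℝ))⁻¹ • ∑ i ∈ Finset.range N, Λ' (scoreTerm C θ g (φ i ω, s i ω)) =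
        √(N : ℝ) • Λ' ((N : ℝ)⁻¹ • linkScore C (fun i => φ i ω) (fun i => s i ω) N g θ) := by
      have hsqrt : (√(N : ℝ))⁻¹ = √(N : ℝ) * (N : ℝ)⁻¹ := by
        rw [← div_eq_mul_inv, Real.sqrt_div_self]
      rw [map_smul, smul_smul, ← hsqrt, linkScore, map_sum]
      rfl
    rw [hscale, ← smul_sub, norm_smul, norm_smul, mul_left_comm]
    exact mul_le_mul_of_nonneg_left hN (norm_nonneg _)

end Estimator

/-! ### Specialization to Gaussian noise -/

section Specialization

variable {n : ℕ} {F : ℝ → ℝ} {g h : ℕ → ℝ → ℝ} {K C : ℝ}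

theorem logLikelihood_eq_linkLogLikelihood (hl : IsRegularLink (responseProb F) g h K)
    (φ : ℕ → EuclideanSpace ℝ (Fin n)) (s : ℕ → ℕ) (N : ℕ) :
    logLikelihood F C φ s N = linkLogLikelihood C φ s N (responseProb F) :=
  funext fun γ => Real.log_prod fun i _ => (hl.pos (s i) (C - ⟪φ i, γ⟫)).ne'

theorem condFisherInfo_eq (hl : IsRegularLink (responseProb F) g h K)
    (θ x : EuclideanSpace ℝ (Fin n)) (a b : Fin n) :
    condFisherInfo F C θ x a b =
      infoWeight (responseProb F) g (C - ⟪x, θ⟫) * (x a * x b) := by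
  have hgrad : ∀ s, gradient (fun γ => Real.log (obsProb F C x s γ)) θ =
      (-g s (C - ⟪x, θ⟫)) • x := fun s => (hasGradientAt_log_link hl C s x θ).gradient
  have hprob : ∀ s, obsProb F C x s θ = responseProb F s (C - ⟪x, θ⟫) := fun _ => rfl
  simp only [condFisherInfo, Matrix.of_apply, hgrad, hprob, infoWeight, PiLp.smul_apply,
    smul_eq_mul]
  rw [Finset.sum_pair zero_ne_one]
  ring

theorem fisherInfo_eq (hl : IsRegularLink (responseProb F) g h K)
    (P : Measure (EuclideanSpace ℝ (Fin n))) (θ : EuclideanSpace ℝ (Fin n)) :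
    fisherInfo F C P θ = weightedInfo C θ P (responseProb F) g := by
  ext a b
  simp only [fisherInfo, weightedInfo, Matrix.of_apply, condFisherInfo_eq hl]

theorem integrable_condFisherInfo (hl : IsRegularLink (responseProb F) g h K)
    {P : Measure (EuclideanSpace ℝ (Fin n))} (hP : Integrable (fun x => ‖x‖ ^ 2) P)
    (θ : EuclideanSpace ℝ (Fin n)) (a b : Fin n) :
    Integrable (fun x => condFisherInfo F C θ x a b) P := by
  have h1 := integrable_infoWeight_mul_inner (C := C) (θ := θ) hl hP
    (EuclideanSpace.single a 1) (EuclideanSpace.single b 1)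
  simpa only [condFisherInfo_eq hl, EuclideanSpace.inner_single_right, conj_trivial, one_mul]
    using h1

end Specialization

end SetValued

/-! ### The main theorem for Gaussian noise -/

theorem theorem1 {Ω : Type*} [MeasurableSpace Ω] (μ : Measure Ω) [IsProbabilityMeasure μ]
    (n : ℕ)
    -- the threshold `C`, the true parameter `θ`, the mean and variance of the Gaussian noise
    (C : ℝ) (θ : EuclideanSpace ℝ (Fin n)) (m : ℝ) (v : ℝ≥0) (hv : v ≠ 0)
    -- the inputs `φ i` and the noises `d i`
    (φ : ℕ → Ω → EuclideanSpace ℝ (Fin n)) (d : ℕ → Ω → ℝ)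
    (hφ : ∀ i, Measurable (φ i)) (hd : ∀ i, Measurable (d i))
    -- the pairs `(φ i, d i)` are i.i.d., with `φ i` independent of `d i`, and `d i` Gaussian
    (hindep : iIndepFun (fun i ω => (φ i ω, d i ω)) μ)
    (hφd : ∀ i, IndepFun (φ i) (d i) μ)
    (hφident : ∀ i, IdentDistrib (φ i) (φ 0) μ μ)
    (hdlaw : ∀ i, μ.map (d i) = gaussianReal m v)
    -- the inputs have a finite second moment and are persistently exciting
    (hmom : MemLp (φ 0) 2 μ)
    (hexc : ∀ᵐ ω ∂μ, ∃ N, (SetValued.excitation (fun i => φ i ω) N).PosDef)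
    -- the binary observations
    (s : ℕ → Ω → ℕ) (hs : ∀ i ω, s i ω = SetValued.obs C θ (φ i ω) (d i ω))
    -- the distribution function of the noise
    (F : ℝ → ℝ) (hF : F = cdf (gaussianReal m v)) :
    -- the Fisher information matrix at `θ` is well defined and invertible
    (∀ a b, Integrable (fun x => SetValued.condFisherInfo F C θ x a b) (μ.map (φ 0))) ∧
    (SetValued.fisherInfo F C (μ.map (φ 0)) θ).PosDef ∧
    ∃ (θhat : ℕ → Ω → EuclideanSpace ℝ (Fin n)) (n₂ : Ω → ℕ),
      -- `θhat N` is a random variable which is a function of the first `N` inputs and observations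
      (∀ N, Measurable[MeasurableSpace.comap
        (fun ω (i : Fin N) => (φ i ω, s i ω)) inferInstance] (θhat N)) ∧
      Measurable n₂ ∧
      -- eventually it solves the likelihood equation and maximizes the likelihood
      (∀ᵐ ω ∂μ, ∀ N, n₂ ω ≤ N →
        SetValued.score F C (fun i => φ i ω) (fun i => s i ω) N (θhat N ω) = 0 ∧
        IsMaxOn (SetValued.logLikelihood F C (fun i => φ i ω) (fun i => s i ω) N)
          Set.univ (θhat N ω)) ∧
      -- strong consistency
      (∀ᵐ ω ∂μ, Tendsto (fun N => θhat N ω) atTop (𝓝 θ)) ∧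
      -- asymptotic normality
      TendstoInDistribution (fun (N : ℕ) ω => √(N : ℝ) • (θhat N ω - θ)) atTop
        (id : EuclideanSpace ℝ (Fin n) → EuclideanSpace ℝ (Fin n)) (fun _ => μ)
        (multivariateGaussian 0 (SetValued.fisherInfo F C (μ.map (φ 0)) θ)⁻¹) := by
  have hl : SetValued.IsRegularLink (SetValued.responseProb F) (SetValued.responseScore m v)
      (SetValued.responseCurvature m v) (1 / v) := hF ▸ SetValued.isRegularLink_gaussian m hv
  set P := μ.map (φ 0) with hPdef
  have hPprob : IsProbabilityMeasure P := Measure.isProbabilityMeasure_map (hφ 0).aemeasurable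
  have hP : Integrable (fun x => ‖x‖ ^ 2) P := by
    rw [hPdef, integrable_map_measure (by fun_prop) (hφ 0).aemeasurable]
    exact hmom.integrable_norm_pow (by norm_num)
  have hφlaw : ∀ i, μ.map (φ i) = P := fun i => (hφident i).map_eq
  have hobs : Measurable fun z : EuclideanSpace ℝ (Fin n) × ℝ =>
      (z.1, SetValued.obs C θ z.1 z.2) := by
    refine measurable_fst.prodMk (Measurable.ite ?_ measurable_const measurable_const)
    exact measurableSet_le (by fun_prop) measurable_const
  have hseq : ∀ i, s i = fun ω => SetValued.obs C θ (φ i ω) (d i ω) := fun i => funext (hs i)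
  have hsm : ∀ i, Measurable (s i) := fun i => by
    rw [hseq i]
    exact measurable_snd.comp (hobs.comp ((hφ i).prodMk (hd i)))
  have hs01 : ∀ i ω, s i ω = 0 ∨ s i ω = 1 := fun i ω => by
    rw [hs, SetValued.obs]
    split_ifs <;> simp
  have hYindep : iIndepFun (fun i ω => (φ i ω, s i ω)) μ := by
    simp only [hseq]
    exact hindep.comp (fun _ z => (z.1, SetValued.obs C θ z.1 z.2)) fun _ => hobs
  have hlaw : ∀ i, μ.map (fun ω => (φ i ω, s i ω)) =
      SetValued.linkLaw C θ P (SetValued.responseProb F) := fun i => by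
    rw [← hφlaw i, hF]
    simp only [hseq]
    exact SetValued.map_obs_eq_linkLaw (hφ i) (hd i) (hφd i) (hdlaw i)
  -- If the common law of the inputs lived on a hyperplane, almost surely all inputs would be
  -- orthogonal to one `u ≠ 0`, and no excitation matrix could be positive definite.
  have hnd : ∀ u : EuclideanSpace ℝ (Fin n), u ≠ 0 → ¬∀ᵐ x ∂P, ⟪x, u⟫ = 0 := by
    intro u hu hae
    have hall : ∀ᵐ ω ∂μ, ∀ i, ⟪φ i ω, u⟫ = 0 := ae_all_iff.2 fun i => by
      rw [← hφlaw i] at hae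
      exact ae_of_ae_map (hφ i).aemeasurable hae
    obtain ⟨ω, hω, N, hN⟩ := (hall.and hexc).exists
    obtain ⟨i, -, hne⟩ := SetValued.inner_ne_zero_of_excitation_posDef hN hu
    exact hne (hω i)
  have hle : ∀ s t, SetValued.responseProb F s t ≤ 1 := by
    intro s t
    rw [hF, SetValued.responseProb]
    split_ifs
    · exact cdf_le_one _ _
    · linarith [cdf_nonneg (gaussianReal m v) t]
  have hM := SetValued.posDef_weightedInfo (C := C) (θ := θ) hl hP hnd
  rw [SetValued.fisherInfo_eq hl]
  refine ⟨SetValued.integrable_condFisherInfo hl hP θ, hM, ?_⟩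
  obtain ⟨θhat, n₂, h1, h2, h3, h4, h5⟩ := SetValued.exists_maximum_likelihood_estimator hl hle hP
    hφ hsm hs01 hYindep hφlaw hlaw hexc hM
  refine ⟨θhat, n₂, h1, h2, ?_, h4, h5⟩
  filter_upwards [h3] with ω hω N hN
  rw [SetValued.score, SetValued.logLikelihood_eq_linkLogLikelihood hl]
  refine ⟨?_, hω N hN⟩
  rw [(SetValued.hasGradientAt_linkLogLikelihood hl _).gradient]
  exact SetValued.linkScore_eq_zero_of_isMaxOn hl (hω N hN)
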